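/- Let $q$ be a prime power. For non-negative integers $a,b$ let $\begin{bmatrix} a\\ b\end{bmatrix}_q=\prod_{i=0}^{b-1}\frac{q^a-q^i}{q^b-q^i}$ if $b\le a$ and $0$ otherwise, and $[r]_q=\begin{bmatrix} r\\ 1\end{bmatrix}_q$. For subspaces of $\mathbb{F}_q^v$ let $d_S(U,W)=\dim(U+W)-\dim(U\cap W)$. A $(v,\#C,d;k)_q$ constant dimension code (CDC) is a set $C$ of $k$-dimensional subspaces of $\mathbb{F}_q^v$ with $d_S(U,W)\ge d$ for all $U\neq W$ in $C$; $A_q(v,d;k)$ is the maximum cardinality of such a code. A linear $m\times n$ MRD code with minimum rank distance $\delta$ over $\mathbb{F}_q$ is a linear subspace $M\le\mathbb{F}_q^{m\times n}$ with $\operatorname{rk}(A-B)\ge\delta$ for all $A\ne B$ in $M$ and with the maximum possible cardinality $\#M=\lceil q^{\max\{m,n\}(\min\{m,n\}-\delta+1)}\rceil$. A lifted MRD (LMRD) code with parameters $v,d,k$ is a set $\{\operatorname{rowspan}(I_k\mid A): A\in M\}$, where $M$ is a linear $k\times(v-k)$ MRD code with minimum rank distance $d/2$. Let $v,d,k$ be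 integers with $d$ even and $2\le d/2\le k\le v/2$. Below, "code" means a $(v,\#C,d;k)_q$ CDC $C$ that contains an LMRD code with parameters $v,d,k$. (1) If $k<d\le 2v/3$, then every code satisfies $$\#C\le q^{(v-k)(k-d/2+1)}+A_q(v-k,2(d-k);d/2).$$ If additionally $d=2k$, $r\equiv v \pmod k$, $0\le r<k$ and $[r]_q<k$, then the right-hand side is equal to $A_q(v,d;k)$ and there is a code whose cardinality equals it. (2) If $(v,d,k)\in\{(6+3l,4+2l,3+l),(6l,4l,3l)\}$ for some integer $l\ge1$, then $k<d\le 2v/3$ and there is a code whose cardinality equals the bound in (1). (3) If $k<d$ and $v<3d/2$, then every code satisfies $\#C\le q^{(v-k)(k-d/2+1)}+1$, and there is a code whose cardinality equals this bound. (4) If $d\le k<3d/2$, then every code satisfies $$\#C\le q^{(v-k)(k-d/2+1)}+A_q(v-k,3d-2k;d)+\frac{\begin{bmatrix} v-k\\ d/2\end{bmatrix}_q\begin{bmatrix} k\\ d-1\end{bmatrix}_q}{\begin{bmatrix} k-d/2\\ d/2-1\end{bmatrix}_q}\,q^{(k-d+1)(v-k-d/2)}.$$ -/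

import Mathlib

namespace LMRDBound

noncomputable section

/-- The `q`-binomial coefficient `∏_{i < k} (q ^ v - q ^ i) / (q ^ k - q ^ i)` as a rational number,
and `0` if `k > v`. -/
def gaussBinom (q v k : ℕ) : ℚ :=
  if k ≤ v then ∏ i ∈ Finset.range k, ((q : ℚ) ^ v - (q : ℚ) ^ i) / ((q : ℚ) ^ k - (q : ℚ) ^ i)
  else 0

/-- The subspace distance `dim (U + W) - dim (U ∩ W)`; the subtraction never truncates, because
`U ∩ W ≤ U + W`. -/
def subspaceDist {F V : Type*} [Field F] [AddCommGroup V] [Module F V]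
    (U W : Submodule F V) : ℕ :=
  Module.finrank F ↥(U ⊔ W) - Module.finrank F ↥(U ⊓ W)

/-- `C` is a `(v, #C, d; k)_q` constant dimension code in `F ^ v`, where `F` has `q` elements. -/
def IsCDC (F : Type*) [Field F] (v d k : ℕ) (C : Finset (Submodule F (Fin v → F))) : Prop :=
  (∀ U ∈ C, Module.finrank F ↥U = k) ∧
    ∀ U ∈ C, ∀ W ∈ C, U ≠ W → d ≤ subspaceDist U W

/-- `A_q(v, d; k)`: the maximum cardinality of a `(v, M, d; k)_q` constant dimension code. -/
def maxCDC (F : Type*) [Field F] (v d k : ℕ) : ℕ :=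
  sSup {n : ℕ | ∃ C : Finset (Submodule F (Fin v → F)), IsCDC F v d k C ∧ C.card = n}

/-- Over a finite field the supremum defining `maxCDC` is an attained maximum. -/
theorem isGreatest_maxCDC (F : Type*) [Field F] [Finite F] (v d k : ℕ) :
    IsGreatest {n : ℕ | ∃ C : Finset (Submodule F (Fin v → F)), IsCDC F v d k C ∧ C.card = n}
      (maxCDC F v d k) := by
  have hfin : Finite (Submodule F (Fin v → F)) :=
    Finite.of_injective (fun U : Submodule F (Fin v → F) => (U : Set (Fin v → F)))
      SetLike.coe_injective
  have hne : {n : ℕ | ∃ C : Finset (Submodule F (Fin v → F)),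
      IsCDC F v d k C ∧ C.card = n}.Nonempty :=
    ⟨0, ∅, by simp [IsCDC], by simp⟩
  have hbdd : BddAbove {n : ℕ | ∃ C : Finset (Submodule F (Fin v → F)),
      IsCDC F v d k C ∧ C.card = n} := by
    refine ⟨Nat.card (Submodule F (Fin v → F)), ?_⟩
    rintro n ⟨C, -, rfl⟩
    have := Fintype.ofFinite (Submodule F (Fin v → F))
    rw [Nat.card_eq_fintype_card]
    exact Finset.card_le_univ C
  exact ⟨Nat.sSup_mem hne hbdd, fun n hn => le_csSup hbdd hn⟩

/-- `M` is a linear maximum rank distance code of `m × n` matrices with minimum rank distance at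
least `δ`: distinct elements differ by a matrix of rank at least `δ`, and the cardinality of `M` is
the maximum possible one, `⌈q ^ (max {m, n} * (min {m, n} - δ + 1))⌉`. -/
def IsMRD {F : Type*} [Field F] {m n : ℕ} (δ : ℕ)
    (M : Submodule F (Matrix (Fin m) (Fin n) F)) : Prop :=
  (∀ A ∈ M, ∀ B ∈ M, A ≠ B → δ ≤ (A - B).rank) ∧
    Nat.card ↥M = ⌈(Nat.card F : ℚ) ^ (((max m n : ℕ) : ℤ) * (((min m n : ℕ) : ℤ) - (δ : ℤ) + 1))⌉₊

/-- The horizontal concatenation `(I_k | A)`. -/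
def prefixId {F : Type*} [Field F] {v k : ℕ} (A : Matrix (Fin k) (Fin (v - k)) F) :
    Matrix (Fin k) (Fin v) F :=
  Matrix.of fun i j =>
    if h : (j : ℕ) < k then (1 : Matrix (Fin k) (Fin k) F) i ⟨j, h⟩
    else A i ⟨j - k, by omega⟩

/-- The row space of a matrix. -/
def rowSpace {F : Type*} [Field F] {m n : ℕ} (A : Matrix (Fin m) (Fin n) F) :
    Submodule F (Fin n → F) :=
  Submodule.span F (Set.range fun i => A i)

/-- `L` is a lifted MRD code in `F ^ v` with parameters `d` and `k`, that is
`L = {rowspan (I_k | A) : A ∈ M}` for a linear `k × (v - k)` MRD code `M` with minimum rank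
distance `d / 2`. -/
def IsLMRD (F : Type*) [Field F] (v d k : ℕ) (L : Set (Submodule F (Fin v → F))) : Prop :=
  ∃ M : Submodule F (Matrix (Fin k) (Fin (v - k)) F),
    IsMRD (d / 2) M ∧ L = {U | ∃ A ∈ M, U = rowSpace (prefixId A)}

/-- `C` is a `(v, #C, d; k)_q` constant dimension code that contains a lifted MRD code with the same
parameters `v`, `d`, `k`. -/
def IsCDCWithLMRD (F : Type*) [Field F] (v d k : ℕ)
    (C : Finset (Submodule F (Fin v → F))) : Prop :=
  IsCDC F v d k C ∧ ∃ L : Set (Submodule F (Fin v → F)), IsLMRD F v d k L ∧ L ⊆ (C : Set _)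

end

end LMRDBound

/-! Write `δ = d / 2` and let `S` be the special subspace of vectors whose first `k` coordinates
vanish, so `dim S = v - k`. A lifted MRD codeword is the graph of `x ↦ x ᵥ* A`. By the cardinality
of the MRD code, every `(k - δ + 1)`-space disjoint from `S` lies in one such graph
(`IsMRD.exists_le_rowSpace`). A further codeword meeting `S` in dimension below `δ` would contain
such a space and so be too close to a graph. Hence all further codewords meet `S` in dimension at
least `δ`, and every upper bound is a count of these (`IsCDCWithLMRD.exists_extra`).

If `k < d`, `δ`-subspaces of the intersections with `S` form a code in `S`; if moreover `v < 3 * δ`,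
there is room for only one. If `d ≤ k < 3 * δ`, codewords meeting `S` in dimension at least `d`
again yield a code in `S`. The others are bounded by double counting pairs of a `δ`-tuple in `S` and
a `(k - 2 * δ + 1)`-tuple independent modulo `S`, since such a pair lies in at most one codeword.

Codes of the required size come from Gabidulin codes by adding products `P × K`, with pairwise
disjoint `(k - δ)`-spaces `P` among the heads and `δ`-spaces `K` among the tails
(`exists_isCDCWithLMRD`). For the two families, dualizing the `K` bounds their number by a count
that the available `P` reach. For `d = 2 * k`, optimality follows from the Năstase–Sissokho bound
`card_partialSpread_le`. -/

namespace LMRDBound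

open Module Polynomial Matrix

/-! ### Gabidulin codes. -/

/-- A nonzero linearized polynomial of `q`-degree less than `t` vanishes only on subspaces of
dimension less than `t`. -/
theorem finrank_lt_of_linearized_eq_zero {F L : Type*} [Field F] [Finite F] [Field L] [Finite L]
    [Algebra F L] {t : ℕ} (c : Fin t → L) (hc : c ≠ 0) (W : Submodule F L)
    (hW : ∀ x ∈ W, ∑ s, c s * x ^ (Nat.card F ^ (s : ℕ)) = 0) : finrank F W < t := by
  classical
  have hq : 1 < Nat.card F := Finite.one_lt_card
  obtain ⟨s₀, hs₀⟩ := Function.ne_iff.mp hc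
  have ht : 0 < t := s₀.pos
  set P : L[X] := ∑ s, Polynomial.C (c s) * X ^ (Nat.card F ^ (s : ℕ)) with hP
  have hcoeff : P.coeff (Nat.card F ^ (s₀ : ℕ)) = c s₀ := by
    rw [hP, finsetSum_coeff, Finset.sum_eq_single s₀]
    · simp
    · intro s _ hs
      rw [coeff_C_mul, coeff_X_pow, if_neg, mul_zero]
      exact fun h => hs (Fin.ext (Nat.pow_right_injective hq h).symm)
    · simp
  have hP0 : P ≠ 0 := by
    intro h
    rw [h] at hcoeff
    exact hs₀ (by simpa using hcoeff.symm)
  have hdeg : P.natDegree ≤ Nat.card F ^ (t - 1) := by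
    refine natDegree_sum_le_of_forall_le _ _ fun s _ => ?_
    refine (natDegree_C_mul_X_pow_le _ _).trans (Nat.pow_le_pow_right hq.le ?_)
    omega
  have hsub : (W : Set L) ⊆ (P.roots.toFinset : Set L) := by
    intro x hx
    simp only [Finset.mem_coe, Multiset.mem_toFinset, mem_roots hP0, IsRoot.def]
    simpa [hP, eval_finsetSum] using hW x hx
  have hcard : Nat.card W ≤ Nat.card F ^ (t - 1) := by
    calc Nat.card W = Set.ncard (W : Set L) := rfl
      _ ≤ Set.ncard (P.roots.toFinset : Set L) := Set.ncard_le_ncard hsub (Finset.finite_toSet _)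
      _ = P.roots.toFinset.card := Set.ncard_coe_finset _
      _ ≤ Multiset.card P.roots := Multiset.toFinset_card_le _
      _ ≤ _ := (card_roots' P).trans hdeg
  rw [Module.natCard_eq_pow_finrank (K := F)] at hcard
  have := (Nat.pow_le_pow_iff_right hq).mp hcard
  omega

theorem rank_add_finrank_ker_vecMulLinear {F : Type*} [Field F] {m n : ℕ}
    (A : Matrix (Fin m) (Fin n) F) :
    A.rank + finrank F (LinearMap.ker A.vecMulLinear) = m := by
  rw [Matrix.rank_eq_finrank_span_row, ← range_vecMulLinear,
    LinearMap.finrank_range_add_finrank_ker, finrank_fin_fun]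

theorem isMRD_iff {F : Type*} [Field F] [Finite F] {m n δ : ℕ} (hδ : δ ≤ m) (hmn : m ≤ n)
    (M : Submodule F (Matrix (Fin m) (Fin n) F)) :
    IsMRD δ M ↔ (∀ A ∈ M, A ≠ 0 → δ ≤ A.rank) ∧
      Nat.card M = Nat.card F ^ (n * (m - δ + 1)) := by
  unfold IsMRD
  have h : ((max m n : ℕ) : ℤ) * (((min m n : ℕ) : ℤ) - (δ : ℤ) + 1)
      = ((n * (m - δ + 1) : ℕ) : ℤ) := by
    rw [max_eq_right hmn, min_eq_left hmn]
    push_cast [Nat.cast_sub hδ]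
    ring
  rw [h, zpow_natCast, ← Nat.cast_pow, Nat.ceil_natCast]
  refine and_congr_left fun _ => ⟨fun H A hA h0 => ?_, fun H A hA B hB hAB => ?_⟩
  · simpa using H A hA 0 M.zero_mem h0
  · exact H _ (M.sub_mem hA hB) (sub_ne_zero.mpr hAB)

/-- Gabidulin codes: linear MRD codes exist for all parameters. -/
theorem exists_isMRD (F : Type*) [Field F] [Finite F] {m n δ : ℕ} (hδ : 1 ≤ δ) (hδm : δ ≤ m)
    (hmn : m ≤ n) : ∃ M : Submodule F (Matrix (Fin m) (Fin n) F), IsMRD δ M := by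
  obtain ⟨p, hp⟩ := CharP.exists F
  have : Fact p.Prime := ⟨(CharP.char_is_prime_or_zero F p).resolve_right
    fun h => CharP.char_ne_zero_of_finite F p h⟩
  have : NeZero n := ⟨by omega⟩
  let L := FiniteField.Extension F p n
  have hL : finrank F L = n := FiniteField.finrank_extension F p n
  let b : Basis (Fin n) F L := (finBasis F L).reindex (finCongr hL)
  let φ : ℕ → (L →ₗ[F] L) := fun i =>
    ((FiniteField.Extension.frob F p n ^ i : Gal(L / F)) : L ≃ₐ[F] L).toLinearMap
  have hφ : ∀ i x, φ i x = x ^ (Nat.card F ^ i) := fun i x =>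
    FiniteField.Extension.frob_iterate_apply F p n i
  -- The code evaluates linearized polynomials of `q`-degree at most `m - δ` at `m` independent
  -- points of `L`; the coordinates of the values are the rows.
  let w : Fin m → L := fun i => b (Fin.castLE hmn i)
  have hw : LinearIndependent F w := b.linearIndependent.comp _ (Fin.castLE_injective hmn)
  let f : (Fin (m - δ + 1) → L) →ₗ[F] (L →ₗ[F] L) :=
    { toFun := fun c => ∑ s, (LinearMap.mulLeft F (c s)) ∘ₗ φ s
      map_add' := fun c c' => by
        ext x; simp [add_mul, Finset.sum_add_distrib]
      map_smul' := fun a c => by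
        ext x; simp [Finset.smul_sum] }
  have hf : ∀ c x, f c x = ∑ s, c s * x ^ (Nat.card F ^ (s : ℕ)) := fun c x => by
    simp [f, hφ]
  let Φ : (Fin (m - δ + 1) → L) →ₗ[F] Matrix (Fin m) (Fin n) F :=
    { toFun := fun c => Matrix.of fun i => b.equivFun (f c (w i))
      map_add' := fun c c' => by ext i j; simp
      map_smul' := fun a c => by ext i j; simp }
  -- By `F`-linearity, the left kernel of `Φ c` corresponds to the zeros of `f c` in the span of the
  -- points.
  have hΦ : ∀ c (x : Fin m → F), x ᵥ* (Φ c) = b.equivFun (f c (∑ i, x i • w i)) := fun c x => by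
    rw [map_sum, map_sum]
    ext j
    simp [Matrix.vecMul, dotProduct, Φ]
  have hrank : ∀ c, c ≠ 0 → δ ≤ (Φ c).rank := fun c hc => by
    have h1 := rank_add_finrank_ker_vecMulLinear (Φ c)
    let g : (Fin m → F) →ₗ[F] L := Fintype.linearCombination F w
    have hg : Function.Injective g := hw.fintypeLinearCombination_injective
    have h2 := finrank_lt_of_linearized_eq_zero c hc
      ((LinearMap.ker (Φ c).vecMulLinear).map g) (by
        rintro _ ⟨x, hx, rfl⟩
        rw [← hf]
        have : x ᵥ* (Φ c) = 0 := hx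
        rw [hΦ, LinearEquiv.map_eq_zero_iff] at this
        simpa only [g, Fintype.linearCombination_apply] using this)
    rw [← (Submodule.equivMapOfInjective g hg _).finrank_eq] at h2
    omega
  have hinj : Function.Injective Φ := by
    refine (injective_iff_map_eq_zero Φ).mpr fun c hc => ?_
    by_contra h0
    have := hrank c h0
    rw [hc, Matrix.rank_zero] at this
    omega
  refine ⟨LinearMap.range Φ, (isMRD_iff hδm hmn _).mpr ⟨?_, ?_⟩⟩
  · rintro _ ⟨c, rfl⟩ h
    exact hrank c fun h0 => h (by rw [h0, map_zero])
  · rw [← Nat.card_congr (LinearEquiv.ofInjective Φ hinj).toEquiv, Nat.card_pi,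
      Finset.prod_const, Module.natCard_eq_pow_finrank (K := F) (V := L), hL, pow_mul]
    simp

/-! ### Subspace distance and constant dimension codes. -/

section Subspaces
variable {F V : Type*} [Field F] [AddCommGroup V] [Module F V]

theorem exists_le_finrank_eq (U : Submodule F V) {t : ℕ} (ht : t ≤ finrank F U) :
    ∃ T ≤ U, finrank F T = t := by
  obtain ⟨f, hf⟩ := exists_linearIndependent_of_le_finrank ht
  have hf' : LinearIndependent F (fun i => (f i : V)) := hf.map' U.subtype U.ker_subtype
  refine ⟨Submodule.span F (Set.range fun i => (f i : V)), ?_, ?_⟩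
  · rw [Submodule.span_le]
    rintro _ ⟨i, rfl⟩
    exact (f i).2
  · simpa using finrank_span_eq_card hf'

variable [FiniteDimensional F V]

theorem exists_le_disjoint_finrank_eq (U S : Submodule F V) {t : ℕ}
    (ht : t + finrank F ↥(U ⊓ S) ≤ finrank F U) :
    ∃ T ≤ U, T ⊓ S = ⊥ ∧ finrank F T = t := by
  obtain ⟨Q, hQ, hQU⟩ := IsModularLattice.exists_disjoint_and_sup_eq (inf_le_left : U ⊓ S ≤ U)
  have h1 := Submodule.finrank_sup_add_finrank_inf_eq (U ⊓ S) Q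
  rw [hQ.eq_bot, hQU, finrank_bot] at h1
  obtain ⟨T, hT, hTt⟩ := exists_le_finrank_eq Q (t := t) (by omega)
  have hQ' : Q ≤ U := hQU ▸ le_sup_right
  refine ⟨T, hT.trans hQ', ?_, hTt⟩
  rw [eq_bot_iff, ← hQ.eq_bot]
  exact le_inf (le_inf (inf_le_left.trans (hT.trans hQ')) inf_le_right) (inf_le_left.trans hT)

theorem subspaceDist_add {U W : Submodule F V} {k : ℕ} (hU : finrank F U = k)
    (hW : finrank F W = k) : subspaceDist U W + 2 * finrank F ↥(U ⊓ W) = 2 * k := by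
  have h := Submodule.finrank_sup_add_finrank_inf_eq U W
  have h' : finrank F ↥(U ⊓ W) ≤ finrank F ↥(U ⊔ W) :=
    Submodule.finrank_mono (inf_le_left.trans le_sup_left)
  unfold subspaceDist
  omega

end Subspaces

/-- For `k`-spaces the distance is `2 * k - 2 * dim (U ⊓ W)`; the additive form avoids truncated
subtraction. -/
theorem isCDC_iff {F : Type*} [Field F] {v d k : ℕ} (C : Finset (Submodule F (Fin v → F))) :
    IsCDC F v d k C ↔ (∀ U ∈ C, finrank F U = k) ∧
      ∀ U ∈ C, ∀ W ∈ C, U ≠ W → d + 2 * finrank F ↥(U ⊓ W) ≤ 2 * k := by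
  refine and_congr_right fun h => forall₂_congr fun U hU => forall₃_congr fun W hW _ => ?_
  have := subspaceDist_add (h U hU) (h W hW)
  omega

/-- A family of pairwise distant subspaces of an `n`-dimensional space is a code. -/
theorem card_le_maxCDC {F W ι : Type*} [Field F] [Finite F] [AddCommGroup W] [Module F W]
    [FiniteDimensional F W] {n d k : ℕ} (hW : finrank F W = n) (hd : 0 < d) (s : Finset ι)
    (K : ι → Submodule F W) (hK : ∀ i ∈ s, finrank F (K i) = k)
    (hdist : ∀ i ∈ s, ∀ j ∈ s, i ≠ j → d + 2 * finrank F ↥(K i ⊓ K j) ≤ 2 * k) :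
    s.card ≤ maxCDC F n d k := by
  classical
  let e : W ≃ₗ[F] (Fin n → F) := LinearEquiv.ofFinrankEq _ _ (by simp [hW])
  -- Positivity of `d` forces distinct indices to give distinct subspaces.
  have hinj : ∀ i ∈ s, ∀ j ∈ s, (K i).map e.toLinearMap = (K j).map e.toLinearMap → i = j := by
    intro i hi j hj hij
    by_contra hne
    have := hdist i hi j hj hne
    rw [Submodule.map_injective_of_injective e.injective hij, inf_idem, hK j hj] at this
    omega
  refine (isGreatest_maxCDC F n d k).2 ⟨s.image fun i => (K i).map e.toLinearMap, ?_,
    Finset.card_image_of_injOn hinj⟩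
  rw [isCDC_iff]
  simp only [Finset.forall_mem_image]
  refine ⟨fun i hi => (e.finrank_map_eq (K i)).trans (hK i hi), fun i hi j hj hij => ?_⟩
  rw [← Submodule.map_inf _ e.injective]
  exact (congrArg (d + 2 * ·) (e.finrank_map_eq (K i ⊓ K j))).trans_le
    (hdist i hi j hj fun h => hij (h ▸ rfl))

/-! ### Lifted codewords as graphs, and the covering property. -/

section Lifting
variable {F : Type*} [Field F] {v k : ℕ}

/-- The first `k` coordinates. -/
def headMap (F : Type*) [Field F] {v k : ℕ} (hk : k ≤ v) : (Fin v → F) →ₗ[F] (Fin k → F) :=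
  LinearMap.funLeft F F (Fin.castLE hk)

/-- The last `v - k` coordinates. -/
def tailMap (F : Type*) [Field F] (v k : ℕ) : (Fin v → F) →ₗ[F] (Fin (v - k) → F) :=
  LinearMap.funLeft F F fun j => ⟨k + j, by omega⟩

theorem head_tail_ext (hk : k ≤ v) {x y : Fin v → F} (h : headMap F hk x = headMap F hk y)
    (t : tailMap F v k x = tailMap F v k y) : x = y := by
  ext j
  by_cases hj : (j : ℕ) < k
  · exact congrFun h ⟨j, hj⟩
  · have := congrFun t ⟨j - k, by omega⟩
    simp only [tailMap, LinearMap.funLeft_apply] at this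
    convert this using 2 <;> (ext; simp; omega)

/-- The splitting of the coordinates into the first `k` and the last `v - k`. -/
noncomputable def splitEquiv (F : Type*) [Field F] {v k : ℕ} (hk : k ≤ v) :
    (Fin v → F) ≃ₗ[F] (Fin k → F) × (Fin (v - k) → F) :=
  LinearEquiv.ofInjectiveOfFinrankEq ((headMap F hk).prod (tailMap F v k))
    (fun _ _ h => head_tail_ext hk (Prod.ext_iff.mp h).1 (Prod.ext_iff.mp h).2)
    (by simp; omega)

theorem headMap_vecMul_prefixId (hk : k ≤ v) (A : Matrix (Fin k) (Fin (v - k)) F)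
    (x : Fin k → F) : headMap F hk (x ᵥ* prefixId A) = x := by
  ext i
  simp [headMap, LinearMap.funLeft_apply, Matrix.vecMul, dotProduct, prefixId, Matrix.one_apply]

theorem tailMap_vecMul_prefixId (A : Matrix (Fin k) (Fin (v - k)) F)
    (x : Fin k → F) : tailMap F v k (x ᵥ* prefixId A) = x ᵥ* A := by
  ext i
  simp [tailMap, LinearMap.funLeft_apply, Matrix.vecMul, dotProduct, prefixId]

theorem rowSpace_eq_range {m n : ℕ} (A : Matrix (Fin m) (Fin n) F) :
    rowSpace A = LinearMap.range A.vecMulLinear := (range_vecMulLinear A).symm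

/-- The row space is the graph of `x ↦ x ᵥ* A`; this description replaces the span in all later
arguments. -/
theorem mem_rowSpace_prefixId (hk : k ≤ v) (A : Matrix (Fin k) (Fin (v - k)) F)
    (w : Fin v → F) : w ∈ rowSpace (prefixId A) ↔ tailMap F v k w = headMap F hk w ᵥ* A := by
  rw [rowSpace_eq_range]
  constructor
  · rintro ⟨x, rfl⟩
    rw [Matrix.vecMulLinear_apply, headMap_vecMul_prefixId hk, tailMap_vecMul_prefixId]
  · intro h
    refine ⟨headMap F hk w, head_tail_ext hk ?_ ?_⟩
    · rw [Matrix.vecMulLinear_apply, headMap_vecMul_prefixId hk]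
    · rw [Matrix.vecMulLinear_apply, tailMap_vecMul_prefixId, h]

theorem finrank_rowSpace_prefixId (hk : k ≤ v) (A : Matrix (Fin k) (Fin (v - k)) F) :
    finrank F (rowSpace (prefixId A)) = k := by
  rw [rowSpace_eq_range, LinearMap.finrank_range_of_inj, finrank_fin_fun]
  exact Function.LeftInverse.injective (g := headMap F hk) (headMap_vecMul_prefixId hk A)

theorem rowSpace_prefixId_injective (hk : k ≤ v) :
    Function.Injective fun A : Matrix (Fin k) (Fin (v - k)) F => rowSpace (prefixId A) := by
  intro A B (h : rowSpace (prefixId A) = rowSpace (prefixId B))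
  refine Matrix.ext_of_single_vecMul fun i => ?_
  generalize (Pi.single i 1 : Fin k → F) = x
  have hx : x ᵥ* prefixId A ∈ rowSpace (prefixId B) := by
    rw [← h, rowSpace_eq_range]
    exact ⟨x, rfl⟩
  rw [mem_rowSpace_prefixId hk, headMap_vecMul_prefixId, tailMap_vecMul_prefixId] at hx
  exact hx

theorem rowSpace_prefixId_inf_ker (hk : k ≤ v) (A : Matrix (Fin k) (Fin (v - k)) F) :
    rowSpace (prefixId A) ⊓ LinearMap.ker (headMap F hk) = ⊥ := by
  rw [eq_bot_iff]
  rintro w ⟨hw, hw0 : headMap F hk w = 0⟩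
  have hw := (mem_rowSpace_prefixId hk A w).mp hw
  rw [hw0, Matrix.zero_vecMul] at hw
  exact head_tail_ext hk (by simpa using hw0) (by simpa using hw)

theorem finrank_map_of_inf_ker_eq_bot {V W : Type*} [AddCommGroup V] [Module F V]
    [AddCommGroup W] [Module F W] (f : V →ₗ[F] W) {T : Submodule F V}
    (hT : T ⊓ LinearMap.ker f = ⊥) : finrank F (T.map f) = finrank F T := by
  rw [← LinearMap.range_domRestrict]
  refine LinearMap.finrank_range_of_inj ?_
  rw [← LinearMap.ker_eq_bot, LinearMap.ker_domRestrict, ← Submodule.disjoint_iff_comap_eq_bot,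
    disjoint_iff, hT]

theorem finrank_ker_headMap (hk : k ≤ v) :
    finrank F (LinearMap.ker (headMap F hk)) = v - k := by
  have h := LinearMap.finrank_range_add_finrank_ker (headMap F hk)
  rw [LinearMap.range_eq_top.mpr, finrank_top, finrank_fin_fun, finrank_fin_fun] at h
  · omega
  · exact fun x => ⟨x ᵥ* prefixId 0, headMap_vecMul_prefixId hk 0 x⟩

/-- A common point of two graphs is determined by its head, which lies in the left kernel of `A -
B`. -/
theorem finrank_rowSpace_prefixId_inf (hk : k ≤ v) (A B : Matrix (Fin k) (Fin (v - k)) F) :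
    (A - B).rank + finrank F ↥(rowSpace (prefixId A) ⊓ rowSpace (prefixId B)) ≤ k := by
  have h := rank_add_finrank_ker_vecMulLinear (A - B)
  have h0 : (rowSpace (prefixId A) ⊓ rowSpace (prefixId B)) ⊓ LinearMap.ker (headMap F hk) = ⊥ := by
    rw [inf_assoc, rowSpace_prefixId_inf_ker hk B, inf_bot_eq]
  have h1 := finrank_map_of_inf_ker_eq_bot _ h0
  have h2 : (rowSpace (prefixId A) ⊓ rowSpace (prefixId B)).map (headMap F hk) ≤
      LinearMap.ker (A - B).vecMulLinear := by
    rintro _ ⟨w, ⟨hA, hB⟩, rfl⟩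
    have hA := (mem_rowSpace_prefixId hk A w).mp hA
    have hB := (mem_rowSpace_prefixId hk B w).mp hB
    rw [LinearMap.mem_ker, Matrix.vecMulLinear_apply, Matrix.vecMul_sub, ← hA, ← hB, sub_self]
  have h3 := Submodule.finrank_mono h2
  omega

/-- Every `(k - δ + 1)`-dimensional subspace that is disjoint from the special subspace lies in a
codeword of the lifted MRD code. -/
theorem IsMRD.exists_le_rowSpace [Finite F] (hkv : 2 * k ≤ v) {δ : ℕ} (hδk : δ ≤ k)
    {M : Submodule F (Matrix (Fin k) (Fin (v - k)) F)} (hM : IsMRD δ M)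
    {T : Submodule F (Fin v → F)}
    (hT : T ⊓ LinearMap.ker (headMap F (show k ≤ v by omega)) = ⊥)
    (hTt : finrank F T = k - δ + 1) : ∃ A ∈ M, T ≤ rowSpace (prefixId A) := by
  have hk : k ≤ v := by omega
  rw [isMRD_iff hδk (by omega)] at hM
  obtain ⟨hrank, hcard⟩ := hM
  let Ψ : M →ₗ[F] (T →ₗ[F] (Fin (v - k) → F)) :=
    { toFun := fun A => A.1.vecMulLinear ∘ₗ headMap F hk ∘ₗ T.subtype
      map_add' := fun A B => by ext x : 1; simp
      map_smul' := fun a A => by ext x : 1; simp }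
  have hΨ : ∀ A x, Ψ A x = headMap F hk (x : Fin v → F) ᵥ* A.1 := fun A x => rfl
  -- A nonzero `A` has left kernel of dimension at most `k - δ`, too small to contain the heads of
  -- `T`.
  have hinj : Function.Injective Ψ := by
    refine (injective_iff_map_eq_zero Ψ).mpr fun A hA => ?_
    by_contra h0
    have h1 := hrank A.1 A.2 fun h => h0 (Subtype.ext h)
    have h2 := rank_add_finrank_ker_vecMulLinear A.1
    have h3 : T.map (headMap F hk) ≤ LinearMap.ker A.1.vecMulLinear := by
      rintro _ ⟨x, hx, rfl⟩
      rw [LinearMap.mem_ker, Matrix.vecMulLinear_apply, ← hΨ A ⟨x, hx⟩, hA]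
      rfl
    have h4 := Submodule.finrank_mono h3
    rw [finrank_map_of_inf_ker_eq_bot _ hT, hTt] at h4
    omega
  -- Both dimensions are `(v - k) * (k - δ + 1)`, so restriction to `T` is onto. As `T` is itself a
  -- graph over its heads, some `A` induces its tail map.
  have hdim : finrank F M = finrank F (T →ₗ[F] (Fin (v - k) → F)) := by
    rw [Module.natCard_eq_pow_finrank (K := F)] at hcard
    rw [Nat.pow_right_injective Finite.one_lt_card hcard, finrank_linearMap, hTt, finrank_fin_fun,
      mul_comm]
  obtain ⟨A, hA⟩ := (LinearMap.injective_iff_surjective_of_finrank_eq_finrank hdim).mp hinj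
    (tailMap F v k ∘ₗ T.subtype)
  refine ⟨A.1, A.2, fun x hx => ?_⟩
  rw [mem_rowSpace_prefixId hk, ← hΨ A ⟨x, hx⟩, hA]
  rfl

/-- A codeword outside the lifted MRD code meets the special subspace in dimension at least
`d / 2`. -/
theorem IsCDC.le_finrank_inf_ker [Finite F] (hkv : 2 * k ≤ v) {δ : ℕ} (hδk : δ ≤ k)
    {C : Finset (Submodule F (Fin v → F))} (hC : IsCDC F v (2 * δ) k C)
    {M : Submodule F (Matrix (Fin k) (Fin (v - k)) F)} (hM : IsMRD δ M)
    (hMC : ∀ A ∈ M, rowSpace (prefixId A) ∈ C) {U : Submodule F (Fin v → F)} (hU : U ∈ C)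
    (hUM : ∀ A ∈ M, U ≠ rowSpace (prefixId A)) :
    δ ≤ finrank F ↥(U ⊓ LinearMap.ker (headMap F (show k ≤ v by omega))) := by
  rw [isCDC_iff] at hC
  by_contra! hlt
  have hUk := hC.1 U hU
  -- A complement of `U ⊓ S` in `U` has dimension at least `k - δ + 1`, one more than two codewords
  -- may share.
  obtain ⟨T, hTU, hT, hTt⟩ := exists_le_disjoint_finrank_eq U
    (LinearMap.ker (headMap F (show k ≤ v by omega))) (t := k - δ + 1) (by omega)
  obtain ⟨A, hA, hTA⟩ := hM.exists_le_rowSpace hkv hδk hT hTt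
  have h1 := hC.2 U hU _ (hMC A hA) (hUM A hA)
  have h2 := Submodule.finrank_mono (le_inf hTU hTA)
  omega

end Lifting

/-! ### Extending a lifted MRD code by products. -/

/-- The product of two submodules is equivalent to the product of their carriers. -/
def submoduleProdEquiv {F V W : Type*} [Field F] [AddCommGroup V] [Module F V] [AddCommGroup W]
    [Module F W] (P : Submodule F V) (K : Submodule F W) : (P.prod K) ≃ₗ[F] P × K where
  toFun x := (⟨x.1.1, x.2.1⟩, ⟨x.1.2, x.2.2⟩)
  invFun x := ⟨(x.1.1, x.2.1), x.1.2, x.2.2⟩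
  map_add' _ _ := rfl
  map_smul' _ _ := rfl
  left_inv _ := rfl
  right_inv _ := rfl

theorem finrank_comap_splitEquiv {F : Type*} [Field F] {v k : ℕ} (hk : k ≤ v)
    (P : Submodule F (Fin k → F)) (K : Submodule F (Fin (v - k) → F)) :
    finrank F ((P.prod K).comap (splitEquiv F hk).toLinearMap) = finrank F P + finrank F K := by
  rw [← finrank_prod, ← (submoduleProdEquiv P K).finrank_eq]
  exact ((splitEquiv F hk).ofSubmodule' (P.prod K)).finrank_eq

/-- The head projection is injective on a graph and maps the intersection into `P`. -/
theorem finrank_rowSpace_inf_comap_splitEquiv {F : Type*} [Field F] {v k : ℕ} (hk : k ≤ v)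
    (A : Matrix (Fin k) (Fin (v - k)) F)
    (P : Submodule F (Fin k → F)) (K : Submodule F (Fin (v - k) → F)) :
    finrank F ↥(rowSpace (prefixId A) ⊓ (P.prod K).comap (splitEquiv F hk).toLinearMap) ≤
      finrank F P := by
  rw [← finrank_map_of_inf_ker_eq_bot (headMap F hk)]
  · refine Submodule.finrank_mono ?_
    rintro _ ⟨w, ⟨-, hw⟩, rfl⟩
    exact hw.1
  · rw [inf_right_comm, rowSpace_prefixId_inf_ker, bot_inf_eq]

theorem card_lifted {F : Type*} [Field F] [Finite F] {v k δ : ℕ} (hkv : 2 * k ≤ v) (hδk : δ ≤ k)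
    {M : Submodule F (Matrix (Fin k) (Fin (v - k)) F)} (hM : IsMRD δ M) :
    {U : Submodule F (Fin v → F) | ∃ A ∈ M, U = rowSpace (prefixId A)}.ncard =
      Nat.card F ^ ((v - k) * (k - δ + 1)) := by
  have h : {U : Submodule F (Fin v → F) | ∃ A ∈ M, U = rowSpace (prefixId A)} =
      (fun A => rowSpace (prefixId A)) '' (M : Set (Matrix (Fin k) (Fin (v - k)) F)) := by
    ext U
    simp [eq_comm]
  rw [h, Set.ncard_image_of_injective _ (rowSpace_prefixId_injective (by omega))]
  exact ((isMRD_iff hδk (by omega) M).mp hM).2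

/-- Products of pairwise disjoint `(k - δ)`-spaces with `δ`-spaces meeting in dimension at most
`k - δ` extend a lifted MRD code. -/
theorem exists_isCDCWithLMRD {F ι : Type*} [Field F] [Finite F] {v k δ : ℕ} (hkv : 2 * k ≤ v)
    (hδ : 1 ≤ δ) (hδk : δ ≤ k) (s : Finset ι)
    (P : ι → Submodule F (Fin k → F)) (K : ι → Submodule F (Fin (v - k) → F))
    (hP : ∀ i ∈ s, finrank F (P i) = k - δ) (hK : ∀ i ∈ s, finrank F (K i) = δ)
    (hPP : ∀ i ∈ s, ∀ j ∈ s, i ≠ j → P i ⊓ P j = ⊥)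
    (hKK : ∀ i ∈ s, ∀ j ∈ s, i ≠ j → finrank F ↥(K i ⊓ K j) ≤ k - δ) :
    ∃ C : Finset (Submodule F (Fin v → F)), IsCDCWithLMRD F v (2 * δ) k C ∧
      C.card = Nat.card F ^ ((v - k) * (k - δ + 1)) + s.card := by
  classical
  have hk : k ≤ v := by omega
  obtain ⟨M, hM⟩ := exists_isMRD F hδ hδk (show k ≤ v - k by omega)
  have hrank := ((isMRD_iff hδk (by omega) M).mp hM).1
  set L := {U : Submodule F (Fin v → F) | ∃ A ∈ M, U = rowSpace (prefixId A)} with hL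
  have hfin : Finite (Submodule F (Fin v → F)) :=
    Finite.of_injective (fun U : Submodule F (Fin v → F) => (U : Set (Fin v → F)))
      SetLike.coe_injective
  let U : ι → Submodule F (Fin v → F) := fun i =>
    ((P i).prod (K i)).comap (splitEquiv F hk).toLinearMap
  have hU : ∀ i ∈ s, finrank F (U i) = k := fun i hi => by
    rw [finrank_comap_splitEquiv, hP i hi, hK i hi]
    omega
  have hUU : ∀ i ∈ s, ∀ j ∈ s, i ≠ j → finrank F ↥(U i ⊓ U j) ≤ k - δ := fun i hi j hj hij => by
    rw [← Submodule.comap_inf, Submodule.prod_inf_prod, finrank_comap_splitEquiv,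
      hPP i hi j hj hij, finrank_bot, zero_add]
    exact hKK i hi j hj hij
  have hLU : ∀ W ∈ L, ∀ i ∈ s, finrank F ↥(W ⊓ U i) ≤ k - δ := by
    rintro _ ⟨A, -, rfl⟩ i hi
    exact (finrank_rowSpace_inf_comap_splitEquiv hk A _ _).trans_eq (hP i hi)
  have hLdim : ∀ W ∈ L, finrank F W = k := by
    rintro _ ⟨A, -, rfl⟩
    exact finrank_rowSpace_prefixId hk A
  have hinj : Set.InjOn U s := by
    intro i hi j hj hij
    by_contra hne
    have := hUU i hi j hj hne
    rw [hij, inf_idem, hU j hj] at this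
    omega
  have hdisj : Disjoint L.toFinite.toFinset (s.image U) := by
    rw [Finset.disjoint_left]
    simp only [Set.Finite.mem_toFinset, Finset.mem_image, not_exists, not_and]
    rintro W hW i hi rfl
    have := hLU _ hW i hi
    rw [inf_idem, hU i hi] at this
    omega
  refine ⟨L.toFinite.toFinset ∪ s.image U, ⟨(isCDC_iff _).mpr ⟨?_, ?_⟩, L, ⟨M, ?_, hL⟩, ?_⟩, ?_⟩
  · intro W hW
    simp only [Finset.mem_union, Set.Finite.mem_toFinset, Finset.mem_image] at hW
    obtain hW | ⟨i, hi, rfl⟩ := hW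
    exacts [hLdim W hW, hU i hi]
  · intro W hW W' hW' hne
    suffices h : finrank F ↥(W ⊓ W') ≤ k - δ by omega
    simp only [Finset.mem_union, Set.Finite.mem_toFinset, Finset.mem_image] at hW hW'
    obtain hW | ⟨i, hi, rfl⟩ := hW <;> obtain hW' | ⟨j, hj, rfl⟩ := hW'
    · obtain ⟨A, hA, rfl⟩ := hW
      obtain ⟨B, hB, rfl⟩ := hW'
      have h1 := hrank (A - B) (M.sub_mem hA hB)
        (sub_ne_zero.mpr fun h => hne (by rw [h]))
      have h2 := finrank_rowSpace_prefixId_inf hk A B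
      omega
    · exact hLU W hW j hj
    · rw [inf_comm]
      exact hLU W' hW' i hi
    · exact hUU i hi j hj fun h => hne (by rw [h])
  · rwa [Nat.mul_div_cancel_left δ two_pos]
  · simp
  · rw [Finset.card_union_of_disjoint hdisj, Finset.card_image_of_injOn hinj,
      ← Set.ncard_eq_toFinset_card, hL, card_lifted hkv hδk hM]

/-! ### Upper bounds from intersections with the special subspace. -/

/-- The codewords outside the lifted MRD code. -/
theorem IsCDCWithLMRD.exists_extra {F : Type*} [Field F] [Finite F] {v k δ : ℕ} (hkv : 2 * k ≤ v)
    (hδk : δ ≤ k) {C : Finset (Submodule F (Fin v → F))} (hC : IsCDCWithLMRD F v (2 * δ) k C) :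
    ∃ D ⊆ C, (∀ U ∈ D, δ ≤ finrank F ↥(U ⊓ LinearMap.ker (headMap F (show k ≤ v by omega)))) ∧
      C.card = Nat.card F ^ ((v - k) * (k - δ + 1)) + D.card := by
  classical
  obtain ⟨hCDC, L, ⟨M, hM, rfl⟩, hLC⟩ := hC
  rw [Nat.mul_div_cancel_left δ two_pos] at hM
  refine ⟨C.filter fun U => ¬ ∃ A ∈ M, U = rowSpace (prefixId A), Finset.filter_subset _ _,
    fun U hU => ?_, ?_⟩
  · simp only [Finset.mem_filter, not_exists, not_and] at hU
    exact hCDC.le_finrank_inf_ker hkv hδk hM (fun A hA => hLC ⟨A, hA, rfl⟩) hU.1 hU.2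
  · rw [← card_lifted hkv hδk hM, ← Finset.card_filter_add_card_filter_not
      (s := C) fun U => ∃ A ∈ M, U = rowSpace (prefixId A), ← Set.ncard_coe_finset]
    congr 2
    ext U
    simpa using fun A hA h => hLC ⟨A, hA, h⟩

theorem card_le_maxCDC_of_le {F V ι : Type*} [Field F] [Finite F] [AddCommGroup V] [Module F V]
    [FiniteDimensional F V] {n d k : ℕ} (S : Submodule F V) (hS : finrank F S = n) (hd : 0 < d)
    (s : Finset ι) (K : ι → Submodule F V) (hKS : ∀ i ∈ s, K i ≤ S)
    (hK : ∀ i ∈ s, finrank F (K i) = k)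
    (hdist : ∀ i ∈ s, ∀ j ∈ s, i ≠ j → d + 2 * finrank F ↥(K i ⊓ K j) ≤ 2 * k) :
    s.card ≤ maxCDC F n d k := by
  refine card_le_maxCDC hS hd s (fun i => (K i).submoduleOf S) (fun i hi => ?_)
    fun i hi j hj hij => ?_
  · rw [(Submodule.submoduleOfEquivOfLe (hKS i hi)).finrank_eq, hK i hi]
  · have h : (K i).submoduleOf S ⊓ (K j).submoduleOf S = (K i ⊓ K j).submoduleOf S := rfl
    rw [h, (Submodule.submoduleOfEquivOfLe (inf_le_left.trans (hKS i hi))).finrank_eq]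
    exact hdist i hi j hj hij

/-- Codewords meeting the special subspace in dimension at least `a > k - d / 2`. -/
theorem card_le_maxCDC_of_le_finrank_inf {F : Type*} [Field F] [Finite F] {v k δ a : ℕ}
    (hk : k ≤ v) (ha : k < a + δ) {C D : Finset (Submodule F (Fin v → F))}
    (hC : IsCDC F v (2 * δ) k C) (hDC : D ⊆ C)
    (hD : ∀ U ∈ D, a ≤ finrank F ↥(U ⊓ LinearMap.ker (headMap F hk))) :
    D.card ≤ maxCDC F (v - k) (2 * (a + δ - k)) a := by
  rw [isCDC_iff] at hC
  -- Outside `D` the value `⊥` is a dummy that makes `K` a total function.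
  have h : ∀ U, ∃ K ≤ U ⊓ LinearMap.ker (headMap F hk), U ∈ D → finrank F K = a := by
    intro U
    by_cases hU : U ∈ D
    · obtain ⟨K, hK, hKa⟩ := exists_le_finrank_eq _ (hD U hU)
      exact ⟨K, hK, fun _ => hKa⟩
    · exact ⟨⊥, bot_le, fun h => absurd h hU⟩
  choose K hKU hK using h
  -- Intersections of codewords have dimension at most `k - δ`, so the `a`-spaces are at distance at
  -- least `2 * a - 2 * (k - δ)`.
  refine card_le_maxCDC_of_le (LinearMap.ker (headMap F hk)) (finrank_ker_headMap hk)
    (by omega) D K (fun U hU => (hKU U).trans inf_le_right) hK fun U hU W hW hne => ?_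
  have h1 := hC.2 U (hDC hU) W (hDC hW) hne
  have h2 := Submodule.finrank_mono
    (inf_le_inf ((hKU U).trans inf_le_left) ((hKU W).trans inf_le_left))
  have := hK U hU
  omega

/-- Two `δ`-spaces in the `(v - k)`-dimensional special subspace share dimension at least `2 * δ -
(v - k)`, which exceeds `k - δ` when `v < 3 * δ`. -/
theorem card_le_one_of_le_finrank_inf {F : Type*} [Field F] {v k δ : ℕ}
    (hk : k ≤ v) (hv : v < 3 * δ) {C D : Finset (Submodule F (Fin v → F))}
    (hC : IsCDC F v (2 * δ) k C) (hDC : D ⊆ C)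
    (hD : ∀ U ∈ D, δ ≤ finrank F ↥(U ⊓ LinearMap.ker (headMap F hk))) : D.card ≤ 1 := by
  rw [isCDC_iff] at hC
  refine Finset.card_le_one.mpr fun U hU W hW => ?_
  by_contra hne
  have h1 := hC.2 U (hDC hU) W (hDC hW) hne
  set S := LinearMap.ker (headMap F hk) with hS
  have h2 := Submodule.finrank_sup_add_finrank_inf_eq (U ⊓ S) (W ⊓ S)
  have h3 : finrank F ↥((U ⊓ S) ⊔ (W ⊓ S)) ≤ finrank F S :=
    Submodule.finrank_mono (sup_le inf_le_right inf_le_right)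
  have h4 : finrank F ↥((U ⊓ S) ⊓ (W ⊓ S)) ≤ finrank F ↥(U ⊓ W) :=
    Submodule.finrank_mono (inf_le_inf inf_le_left inf_le_left)
  have h5 : finrank F S = v - k := finrank_ker_headMap hk
  have := hD U hU
  have := hD W hW
  omega

/-! ### Double counting of tuples. -/

theorem card_linearIndependent_in {F V : Type*} [Field F] [Finite F] [AddCommGroup V] [Module F V]
    {n : ℕ} (Y : Submodule F V) [FiniteDimensional F Y] (hn : n ≤ finrank F Y) :
    {a : Fin n → V | (∀ i, a i ∈ Y) ∧ LinearIndependent F a}.ncard =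
      ∏ i ∈ Finset.range n, (Nat.card F ^ finrank F Y - Nat.card F ^ i) := by
  have := Fintype.ofFinite F
  have : Finite Y := Module.finite_of_finite F
  rw [← Fin.prod_univ_eq_prod_range fun i => Nat.card F ^ finrank F Y - Nat.card F ^ i,
    Nat.card_eq_fintype_card, ← card_linearIndependent hn, ← Nat.card_coe_set_eq]
  refine Nat.card_congr
    { toFun := fun a => ⟨fun i => ⟨a.1 i, a.2.1 i⟩, LinearIndependent.of_comp Y.subtype a.2.2⟩
      invFun := fun a => ⟨fun i => a.1 i, fun i => (a.1 i).2, a.2.map' Y.subtype Y.ker_subtype⟩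
      left_inv := fun _ => rfl
      right_inv := fun _ => rfl }

/-- With a linear section `g` of `f` on `U`, a tuple amounts to an independent tuple of images
together with an arbitrary correction in `U ⊓ ker f` for each entry. -/
theorem card_linearIndependent_comp {F V W : Type*} [Field F] [Finite F] [AddCommGroup V]
    [Module F V] [FiniteDimensional F V] [AddCommGroup W] [Module F W] {m : ℕ}
    (U : Submodule F V) (f : V →ₗ[F] W) (hm : m ≤ finrank F (U.map f)) :
    {b : Fin m → V | (∀ i, b i ∈ U) ∧ LinearIndependent F (f ∘ b)}.ncard =
      Nat.card F ^ (finrank F ↥(U ⊓ LinearMap.ker f) * m) *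
        ∏ i ∈ Finset.range m, (Nat.card F ^ finrank F (U.map f) - Nat.card F ^ i) := by
  have : Finite V := Module.finite_of_finite F
  obtain ⟨g, hg⟩ := (f.submoduleMap U).exists_rightInverse_of_surjective
    (LinearMap.range_eq_top.mpr (f.submoduleMap_surjective U))
  have hfg : ∀ y : U.map f, f (g y) = y := fun y =>
    congrArg Subtype.val (LinearMap.congr_fun hg y)
  rw [← card_linearIndependent_in (U.map f) hm, pow_mul, ← Module.natCard_eq_pow_finrank,
    ← Nat.card_coe_set_eq, ← Nat.card_coe_set_eq, mul_comm]
  have hpi : Nat.card ↥(U ⊓ LinearMap.ker f) ^ m = Nat.card (Fin m → ↥(U ⊓ LinearMap.ker f)) := by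
    simp [Nat.card_pi]
  rw [hpi, ← Nat.card_prod]
  refine Nat.card_congr
    { toFun := fun b => (⟨f ∘ b.1, fun i => ⟨b.1 i, b.2.1 i, rfl⟩, b.2.2⟩,
        fun i => ⟨b.1 i - g ⟨f (b.1 i), b.1 i, b.2.1 i, rfl⟩,
          U.sub_mem (b.2.1 i) (g _).2, by simp [hfg]⟩)
      invFun := fun c => ⟨fun i => (c.2 i : V) + g ⟨c.1.1 i, c.1.2.1 i⟩,
        fun i => U.add_mem (c.2 i).2.1 (g _).2, ?_⟩
      left_inv := fun b => by ext; simp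
      right_inv := fun c => ?_ }
  · convert c.1.2.2 using 1
    ext i
    have : f (c.2 i) = 0 := (c.2 i).2.2
    simp [hfg, this]
  · have h : ∀ i, f (c.2 i) = 0 := fun i => (c.2 i).2.2
    refine Prod.ext (Subtype.ext (funext fun i => ?_)) (funext fun i => Subtype.ext ?_)
    · simp [hfg, h]
    · simp [hfg, h]

theorem le_finrank_of_linearIndependent {F V : Type*} [Field F] [AddCommGroup V]
    [Module F V] [FiniteDimensional F V] {n : ℕ} {Y : Submodule F V} {a : Fin n → V}
    (ha : LinearIndependent F a) (hY : ∀ i, a i ∈ Y) : n ≤ finrank F Y := by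
  have h : LinearIndependent F fun i => (⟨a i, hY i⟩ : Y) := LinearIndependent.of_comp Y.subtype ha
  simpa using h.fintype_card_le_finrank

theorem finrank_map_add_finrank_inf_ker {F V W : Type*} [Field F] [AddCommGroup V]
    [Module F V] [FiniteDimensional F V] [AddCommGroup W] [Module F W] (U : Submodule F V)
    (f : V →ₗ[F] W) : finrank F (U.map f) + finrank F ↥(U ⊓ LinearMap.ker f) = finrank F U := by
  rw [← LinearMap.finrank_range_add_finrank_ker (f.domRestrict U), LinearMap.range_domRestrict,
    LinearMap.ker_domRestrict]
  congr 1
  rw [(Submodule.equivMapOfInjective U.subtype U.injective_subtype _).finrank_eq,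
    Submodule.map_comap_subtype]

/-- The number of pairs of a linearly independent `δ`-tuple in an `e`-space and an `m`-tuple in a
`(j + e)`-space that is linearly independent modulo the `e`-space. -/
def pairCount (q δ m e j : ℕ) : ℕ :=
  (∏ i ∈ Finset.range δ, (q ^ e - q ^ i)) *
    (q ^ (e * m) * ∏ i ∈ Finset.range m, (q ^ j - q ^ i))

/-- Double counting of the pairs of tuples covered by codewords. -/
theorem sum_pairCount_le {F V W : Type*} [Field F] [Finite F] [AddCommGroup V]
    [Module F V] [FiniteDimensional F V] [AddCommGroup W] [Module F W] [FiniteDimensional F W]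
    {δ m : ℕ} (f : V →ₗ[F] W) (hf : Function.Surjective f) (D : Finset (Submodule F V))
    (hδ : ∀ U ∈ D, δ ≤ finrank F ↥(U ⊓ LinearMap.ker f))
    (hm : ∀ U ∈ D, m ≤ finrank F (U.map f))
    (hD : ∀ U ∈ D, ∀ U' ∈ D, U ≠ U' → finrank F ↥(U ⊓ U') < δ + m)
    (hδ' : δ ≤ finrank F (LinearMap.ker f)) (hm' : m ≤ finrank F W) :
    ∑ U ∈ D, pairCount (Nat.card F) δ m (finrank F ↥(U ⊓ LinearMap.ker f)) (finrank F (U.map f)) ≤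
      pairCount (Nat.card F) δ m (finrank F (LinearMap.ker f)) (finrank F W) := by
  classical
  have : Finite V := Module.finite_of_finite F
  let X : Submodule F V → Set ((Fin δ → V) × (Fin m → V)) := fun U =>
    {a | (∀ i, a i ∈ U ⊓ LinearMap.ker f) ∧ LinearIndependent F a} ×ˢ
      {b | (∀ i, b i ∈ U) ∧ LinearIndependent F (f ∘ b)}
  have hX : ∀ U, δ ≤ finrank F ↥(U ⊓ LinearMap.ker f) → m ≤ finrank F (U.map f) → (X U).ncard =
      pairCount (Nat.card F) δ m (finrank F ↥(U ⊓ LinearMap.ker f)) (finrank F (U.map f)) := by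
    intro U h1 h2
    rw [Set.ncard_prod, card_linearIndependent_in _ h1, card_linearIndependent_comp _ _ h2]
    rfl
  have htop := hX ⊤ (by rwa [top_inf_eq])
    (by rwa [Submodule.map_top, LinearMap.range_eq_top.mpr hf, finrank_top])
  rw [top_inf_eq, Submodule.map_top, LinearMap.range_eq_top.mpr hf, finrank_top] at htop
  rw [← htop, ← Finset.sum_congr rfl fun U hU => hX U (hδ U hU) (hm U hU)]
  have hsum : ∑ U ∈ D, (X U).ncard = (D.biUnion fun U => (X U).toFinite.toFinset).card := by
    rw [Finset.card_biUnion]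
    · exact Finset.sum_congr rfl fun U _ => Set.ncard_eq_toFinset_card _
    -- A pair covered by both `U` and `U'` would force `dim (U ⊓ U') ≥ δ + m`: `δ` from the kernel
    -- and `m` from the image.
    · intro U hU U' hU' hne
      refine Finset.disjoint_left.mpr ?_
      simp only [Set.Finite.mem_toFinset]
      rintro ⟨a, b⟩ ⟨⟨ha, hla⟩, hb, hlb⟩ ⟨⟨ha', -⟩, hb', -⟩
      have h1 : δ ≤ finrank F ↥((U ⊓ U') ⊓ LinearMap.ker f) :=
        le_finrank_of_linearIndependent hla fun i => ⟨⟨(ha i).1, (ha' i).1⟩, (ha i).2⟩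
      have h2 : m ≤ finrank F ((U ⊓ U').map f) :=
        le_finrank_of_linearIndependent hlb fun i => ⟨b i, ⟨hb i, hb' i⟩, rfl⟩
      have h3 := finrank_map_add_finrank_inf_ker (U ⊓ U') f
      have h4 := hD U hU U' hU' hne
      omega
  rw [hsum, ← Set.ncard_coe_finset]
  refine Set.ncard_le_ncard ?_ (Set.toFinite _)
  intro x hx
  simp only [Finset.coe_biUnion, Set.Finite.coe_toFinset, Set.mem_iUnion] at hx
  obtain ⟨U, -, ⟨ha, hla⟩, hb, hlb⟩ := hx
  exact ⟨⟨fun i => ⟨trivial, (ha i).2⟩, hla⟩, fun i => trivial, hlb⟩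

/-! ### Identities and inequalities for `q`-products. -/

section Numbers

/-- The product `∏_{i < b} (q ^ a - q ^ i)` over the rationals. -/
def qProd (q a b : ℕ) : ℚ := ∏ i ∈ Finset.range b, ((q : ℚ) ^ a - (q : ℚ) ^ i)

variable {q : ℕ}

theorem qProd_pos (hq : 1 < q) {a b : ℕ} (h : b ≤ a) : 0 < qProd q a b := by
  refine Finset.prod_pos fun i hi => sub_pos.mpr ?_
  exact pow_lt_pow_right₀ (by exact_mod_cast hq) ((Finset.mem_range.mp hi).trans_le h)

theorem qProd_succ_right (a b : ℕ) : qProd q a (b + 1) = qProd q a b * ((q : ℚ) ^ a - (q : ℚ) ^ b) :=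
  Finset.prod_range_succ _ _

theorem qProd_succ_succ (a b : ℕ) :
    qProd q (a + 1) (b + 1) = ((q : ℚ) ^ (a + 1) - 1) * (q : ℚ) ^ b * qProd q a b := by
  unfold qProd
  rw [Finset.prod_range_succ', pow_zero, mul_comm, mul_assoc]
  congr 1
  have h : ∀ i, (q : ℚ) ^ (a + 1) - (q : ℚ) ^ (i + 1) = q * ((q : ℚ) ^ a - (q : ℚ) ^ i) :=
    fun i => by ring
  simp_rw [h, Finset.prod_mul_distrib, Finset.prod_const, Finset.card_range]

theorem gaussBinom_eq_div {a b : ℕ} (h : b ≤ a) : gaussBinom q a b = qProd q a b / qProd q b b := by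
  rw [gaussBinom, if_pos h, Finset.prod_div_distrib]
  rfl

/-- The last `b` factors satisfy `q ^ (a + b) - q ^ (a + i) = q ^ a * (q ^ b - q ^ i)`. -/
theorem qProd_add_self (a b : ℕ) :
    qProd q (a + b) (a + b) = qProd q (a + b) a * ((q : ℚ) ^ (a * b) * qProd q b b) := by
  unfold qProd
  rw [Finset.prod_range_add]
  congr 1
  have h : ∀ i, (q : ℚ) ^ (a + b) - (q : ℚ) ^ (a + i) = q ^ a * ((q : ℚ) ^ b - (q : ℚ) ^ i) :=
    fun i => by ring
  simp_rw [h, Finset.prod_mul_distrib, Finset.prod_const, Finset.card_range, pow_mul]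

theorem gaussBinom_symm (hq : 1 < q) (a b : ℕ) : gaussBinom q (a + b) a = gaussBinom q (a + b) b := by
  have h1 := qProd_add_self (q := q) a b
  have h2 := qProd_add_self (q := q) b a
  rw [add_comm b a, mul_comm b a] at h2
  rw [gaussBinom_eq_div (Nat.le_add_right a b), gaussBinom_eq_div (Nat.le_add_left b a),
    div_eq_div_iff (qProd_pos hq le_rfl).ne' (qProd_pos hq le_rfl).ne']
  have h3 : (q : ℚ) ^ (a * b) ≠ 0 := pow_ne_zero _ (by positivity)
  apply mul_left_cancel₀ h3
  linear_combination h2 - h1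

/-- Under these hypotheses no natural subtraction in `pairCount` truncates. -/
theorem pairCount_cast (hq : 1 < q) {δ m e j : ℕ} (hδ : δ ≤ e) (hm : m ≤ j) :
    (pairCount q δ m e j : ℚ) = qProd q e δ * ((q : ℚ) ^ (e * m) * qProd q j m) := by
  have h : ∀ a b, b ≤ a →
      ((∏ i ∈ Finset.range b, (q ^ a - q ^ i) : ℕ) : ℚ) = qProd q a b := fun a b hab => by
    rw [Nat.cast_prod]
    refine Finset.prod_congr rfl fun i hi => ?_
    rw [Nat.cast_sub (Nat.pow_le_pow_right hq.le ((Finset.mem_range.mp hi).le.trans hab))]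
    push_cast
    rfl
  rw [pairCount, Nat.cast_mul, Nat.cast_mul, h _ _ hδ, h _ _ hm, Nat.cast_pow]

/-- Trading an image dimension for a kernel dimension does not lower the count, so codewords meeting
the special subspace in dimension exactly `δ` cover the fewest pairs. After removing common factors
this is `h1`, where `1 ≤ b` supplies `q ≤ q ^ b`. -/
theorem pairCount_le_succ (hq : 1 < q) {b c e j : ℕ} (hb : 1 ≤ b) (he : b + 1 ≤ e) (hj : c + 1 ≤ j) :
    (pairCount q (b + 1) (c + 1) e (j + 1) : ℚ) ≤ pairCount q (b + 1) (c + 1) (e + 1) j := by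
  rw [pairCount_cast hq he (by omega), pairCount_cast hq (by omega) hj, qProd_succ_right,
    qProd_succ_succ, qProd_succ_succ, qProd_succ_right]
  have hq' : (2 : ℚ) ≤ q := by exact_mod_cast hq
  have hP := qProd_pos hq (show b ≤ e by omega)
  have hP' := qProd_pos hq (show c ≤ j by omega)
  set x : ℚ := (q : ℚ)
  have hE : 1 ≤ x ^ e := one_le_pow₀ (by linarith)
  have hB : x ≤ x ^ b := le_self_pow₀ (by linarith) (by omega)
  have hJ : x ^ c * x ≤ x ^ j := by
    rw [← pow_succ]
    exact pow_le_pow_right₀ (by linarith) hj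
  have hC : 0 < x ^ c := by positivity
  have h1 : (x ^ e - x ^ b) * (x ^ (j + 1) - 1) ≤ (x ^ (e + 1) - 1) * (x ^ b * x * (x ^ j - x ^ c)) := by
    have h2 : x ^ e - x ^ b ≤ x ^ (e + 1) - 1 := by
      rw [pow_succ]
      nlinarith
    have h3 : x ^ (j + 1) - 1 ≤ x ^ b * x * (x ^ j - x ^ c) := by
      have h4 : 0 ≤ x ^ j - x ^ c := by nlinarith
      have h5 : x ^ j ≤ x * (x ^ j - x ^ c) := by nlinarith
      have h6 : x * (x ^ j - x ^ c) ≤ x ^ b * (x ^ j - x ^ c) :=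
        mul_le_mul_of_nonneg_right hB h4
      have h7 : x ^ (j + 1) = x * x ^ j := pow_succ' _ _
      nlinarith
    exact mul_le_mul h2 h3 (sub_nonneg.mpr (one_le_pow₀ (by linarith)))
      (sub_nonneg.mpr (one_le_pow₀ (by linarith)))
  have h8 := mul_le_mul_of_nonneg_left h1
    (show 0 ≤ qProd q e b * qProd q j c * x ^ (e * (c + 1)) * x ^ c by positivity)
  refine (le_of_eq ?_).trans (h8.trans (le_of_eq ?_)) <;> ring

theorem pairCount_le_add (hq : 1 < q) {b c : ℕ} (hb : 1 ≤ b) (s : ℕ) {e j : ℕ} (he : b + 1 ≤ e)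
    (hj : c + 1 ≤ j) :
    (pairCount q (b + 1) (c + 1) e (j + s) : ℚ) ≤ pairCount q (b + 1) (c + 1) (e + s) j := by
  induction s generalizing e with
  | zero => rfl
  | succ s ih =>
    refine (pairCount_le_succ hq hb he (show c + 1 ≤ j + s by omega)).trans ?_
    rw [show e + (s + 1) = e + 1 + s by omega]
    exact ih (by omega)

end Numbers

/-- Codewords that meet the special subspace in a dimension between `d / 2` and `d - 1`. -/
theorem card_le_of_finrank_inf_lt {F : Type*} [Field F] [Finite F] {v k δ : ℕ}
    (hkv : 2 * k ≤ v) (hδ : 2 ≤ δ) (hδk : 2 * δ ≤ k) {C D : Finset (Submodule F (Fin v → F))}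
    (hC : IsCDC F v (2 * δ) k C) (hDC : D ⊆ C)
    (hD : ∀ U ∈ D, δ ≤ finrank F ↥(U ⊓ LinearMap.ker (headMap F (show k ≤ v by omega))))
    (hD' : ∀ U ∈ D, finrank F ↥(U ⊓ LinearMap.ker (headMap F (show k ≤ v by omega))) < 2 * δ) :
    (D.card : ℚ) ≤ gaussBinom (Nat.card F) (v - k) δ * gaussBinom (Nat.card F) k (2 * δ - 1)
      * (Nat.card F : ℚ) ^ ((k - 2 * δ + 1) * (v - k - δ))
      / gaussBinom (Nat.card F) (k - δ) (δ - 1) := by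
  have hk : k ≤ v := by omega
  rw [isCDC_iff] at hC
  have hq : 1 < Nat.card F := Finite.one_lt_card
  -- Here `b = δ - 1`, `c = k - 2 * δ` and `n = v - k - δ`; the second tuple has length `c + 1`, so
  -- a pair spans `k - δ + 1` dimensions.
  obtain ⟨b, rfl⟩ : ∃ b, δ = b + 1 := ⟨δ - 1, by omega⟩
  obtain ⟨c, hkdef⟩ : ∃ c, k = 2 * (b + 1) + c := ⟨k - 2 * (b + 1), by omega⟩
  obtain ⟨n, hn⟩ : ∃ n, v = k + (b + 1 + n) := ⟨v - k - (b + 1), by omega⟩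
  have hrk : ∀ U ∈ D, finrank F (U.map (headMap F hk)) +
      finrank F ↥(U ⊓ LinearMap.ker (headMap F hk)) = k := fun U hU => by
    rw [finrank_map_add_finrank_inf_ker, hC.1 U (hDC hU)]
  have hker : finrank F (LinearMap.ker (headMap F hk)) = b + 1 + n := by
    rw [finrank_ker_headMap]
    omega
  have hsum := sum_pairCount_le (δ := b + 1) (m := c + 1) (headMap F hk)
    (fun x => ⟨x ᵥ* prefixId 0, headMap_vecMul_prefixId hk 0 x⟩) D hD
    (fun U hU => by have := hrk U hU; have := hD' U hU; omega)
    (fun U hU U' hU' hne => by have := hC.2 U (hDC hU) U' (hDC hU') hne; omega)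
    (by omega) (by rw [finrank_fin_fun]; omega)
  rw [hker, finrank_fin_fun] at hsum
  set q := Nat.card F
  have hmin : ∀ U ∈ D, (pairCount q (b + 1) (c + 1) (b + 1) (b + 1 + c) : ℚ) ≤
      pairCount q (b + 1) (c + 1) (finrank F ↥(U ⊓ LinearMap.ker (headMap F hk)))
        (finrank F (U.map (headMap F hk))) := fun U hU => by
    have h1 := hrk U hU
    have h2 := hD U hU
    have h3 := hD' U hU
    obtain ⟨s, hs⟩ := Nat.exists_eq_add_of_le h2
    rw [hs] at h1 h3 ⊢
    have := pairCount_le_add hq (show 1 ≤ b by omega) s le_rfl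
      (show c + 1 ≤ finrank F (U.map (headMap F hk)) by omega)
    rwa [show finrank F (U.map (headMap F hk)) + s = b + 1 + c by omega] at this
  have hle : (D.card : ℚ) * pairCount q (b + 1) (c + 1) (b + 1) (b + 1 + c) ≤
      pairCount q (b + 1) (c + 1) (b + 1 + n) k := by
    rw [← nsmul_eq_mul]
    refine (Finset.card_nsmul_le_sum _ _ _ hmin).trans ?_
    exact_mod_cast hsum
  rw [pairCount_cast hq le_rfl (by omega), pairCount_cast hq (by omega) (by omega)] at hle
  have e1 : v - k = b + 1 + n := by omega
  have e3 : k - 2 * (b + 1) + 1 = c + 1 := by omega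
  have e4 : k - (b + 1) = b + (c + 1) := by omega
  have e5 : b + 1 + c = b + (c + 1) := by omega
  have e6 : k = (2 * (b + 1) - 1) + (c + 1) := by omega
  -- Symmetry turns the stated coefficients into those with lower index `c + 1`, which the count
  -- produces.
  have g1 : gaussBinom q k (2 * (b + 1) - 1) = gaussBinom q k (c + 1) := by
    rw [e6]
    exact gaussBinom_symm hq _ _
  rw [e1, Nat.add_sub_cancel_left, e3, e4, g1, Nat.add_sub_cancel, gaussBinom_symm hq b (c + 1),
    gaussBinom_eq_div (by omega), gaussBinom_eq_div (by omega), gaussBinom_eq_div (by omega)]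
  rw [e5] at hle
  have p1 := qProd_pos hq (le_refl (b + 1))
  have p2 := qProd_pos hq (le_refl (c + 1))
  have p3 := qProd_pos hq (show c + 1 ≤ b + (c + 1) by omega)
  have p4 : (0 : ℚ) < (q : ℚ) ^ ((b + 1) * (c + 1)) := by positivity
  rw [div_mul_div_comm, div_mul_eq_mul_div, div_div_div_eq, le_div_iff₀ (by positivity)]
  have h := mul_le_mul_of_nonneg_left hle
    (show 0 ≤ qProd q (c + 1) (c + 1) / (q : ℚ) ^ ((b + 1) * (c + 1)) by positivity)
  refine (le_of_eq ?_).trans (h.trans (le_of_eq ?_))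
  · field_simp
  · rw [show (b + 1 + n) * (c + 1) = (b + 1) * (c + 1) + (c + 1) * n by ring, pow_add]
    field_simp

/-! ### Holes of partial spreads and the Năstase–Sissokho bound. -/

section Holes
variable {F V : Type*} [Field F] [AddCommGroup V] [Module F V] [FiniteDimensional F V]

theorem card_dual_vanishing {x : V} (hx : x ≠ 0) :
    Nat.card F * {φ : Dual F V | φ x = 0}.ncard = Nat.card F ^ finrank F V := by
  have h1 := Subspace.finrank_add_finrank_dualAnnihilator_eq (F ∙ x)
  rw [finrank_span_singleton hx] at h1
  have h2 : {φ : Dual F V | φ x = 0} = ((F ∙ x).dualAnnihilator : Set (Dual F V)) := by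
    ext φ
    simp only [Set.mem_ofPred_eq, SetLike.mem_coe, Submodule.mem_dualAnnihilator,
      Submodule.mem_span_singleton]
    exact ⟨fun h => by rintro _ ⟨a, rfl⟩; simp [h], fun h => h x ⟨1, one_smul _ _⟩⟩
  have h3 : ((F ∙ x).dualAnnihilator : Set (Dual F V)).ncard =
      Nat.card F ^ finrank F (F ∙ x).dualAnnihilator :=
    Module.natCard_eq_pow_finrank (K := F) (V := (F ∙ x).dualAnnihilator)
  rw [h2, h3, ← h1, pow_add, pow_one]

variable [Finite F]

/-- Some hyperplane contains at most the average share of a set of nonzero vectors. -/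
theorem exists_dual_card_le (hV : 0 < finrank F V) (T : Set V) (hT : (0 : V) ∉ T) :
    ∃ φ : Dual F V, φ ≠ 0 ∧
      Nat.card F * (T ∩ {x | φ x = 0}).ncard ≤ T.ncard := by
  classical
  have : Finite V := Module.finite_of_finite F
  have : Finite (Dual F V) := Module.finite_of_finite F
  have := Fintype.ofFinite V
  have := Fintype.ofFinite (Dual F V)
  -- Pairs `(φ, x)` with `φ x = 0` are counted in two ways; the zero functional, which vanishes on
  -- all of `T`, already contributes more than its average share.
  by_contra! hcon
  have hq : 1 < Nat.card F := Finite.one_lt_card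
  have hdc := Finset.sum_card_bipartiteAbove_eq_sum_card_bipartiteBelow
    (s := (Finset.univ : Finset (Dual F V))) (t := T.toFinset) (fun φ x => φ x = 0)
  have hleft : ∀ φ : Dual F V, (T.toFinset.bipartiteAbove (fun φ x => φ x = 0) φ).card =
      (T ∩ {x | φ x = 0}).ncard := fun φ => by
    rw [← Set.ncard_coe_finset]
    congr 1
    ext x
    simp [Finset.bipartiteAbove]
  have hright : ∀ x ∈ T.toFinset, Nat.card F *
      ((Finset.univ : Finset (Dual F V)).bipartiteBelow (fun φ x => φ x = 0) x).card =
      Nat.card F ^ finrank F V := fun x hx => by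
    rw [← card_dual_vanishing (F := F) (x := x) fun h => hT (by simpa [h] using hx),
      ← Set.ncard_coe_finset]
    congr 2
    ext φ
    simp [Finset.bipartiteBelow]
  have hsum : Nat.card F * ∑ φ : Dual F V, (T ∩ {x | φ x = 0}).ncard =
      T.ncard * Nat.card F ^ finrank F V := by
    rw [← Finset.sum_congr rfl fun φ _ => hleft φ, hdc, Finset.mul_sum,
      Finset.sum_congr rfl hright, Finset.sum_const, smul_eq_mul, Set.ncard_eq_toFinset_card']
  have hcard : (Finset.univ.erase (0 : Dual F V)).card + 1 = Nat.card F ^ finrank F V := by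
    rw [Finset.card_erase_add_one (Finset.mem_univ _), Finset.card_univ, ← Nat.card_eq_fintype_card,
      Module.natCard_eq_pow_finrank (K := F), Subspace.dual_finrank_eq]
  have h0 : (T ∩ {x | (0 : Dual F V) x = 0}).ncard = T.ncard := by simp
  rw [← Finset.add_sum_erase _ _ (Finset.mem_univ (0 : Dual F V)), h0, mul_add,
    Finset.mul_sum, ← hcard] at hsum
  have hge := Finset.card_nsmul_le_sum (Finset.univ.erase (0 : Dual F V))
    (fun φ => Nat.card F * (T ∩ {x | φ x = 0}).ncard) (T.ncard + 1)
    fun φ hφ => hcon φ (Finset.ne_of_mem_erase hφ)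
  have hpos : 1 < Nat.card F ^ finrank F V := Nat.one_lt_pow hV.ne' hq
  rw [smul_eq_mul] at hge
  nlinarith

theorem exists_hyperplane_card_le (H : Submodule F V) (hH : 0 < finrank F H) (T : Set V)
    (hT : (0 : V) ∉ T) : ∃ H' ≤ H, finrank F H' + 1 = finrank F H ∧
      Nat.card F * (T ∩ H').ncard ≤ (T ∩ H).ncard := by
  obtain ⟨φ, hφ, hle⟩ := exists_dual_card_le hH (H.subtype ⁻¹' T) (by simpa using hT)
  refine ⟨(LinearMap.ker φ).map H.subtype, Submodule.map_subtype_le _ _, ?_, ?_⟩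
  · rw [← (Submodule.equivMapOfInjective H.subtype H.injective_subtype _).finrank_eq,
      Module.Dual.finrank_ker_add_one_of_ne_zero hφ]
  · convert hle using 1
    · congr 1
      rw [← Set.ncard_image_of_injective _ H.injective_subtype]
      congr 1
      ext x
      simp only [Set.mem_inter_iff, SetLike.mem_coe, Submodule.mem_map, LinearMap.mem_ker,
        Set.mem_image, Set.mem_preimage, Set.mem_ofPred_eq]
      constructor
      · rintro ⟨hx, y, hy, rfl⟩
        exact ⟨y, ⟨hx, hy⟩, rfl⟩
      · rintro ⟨y, ⟨hx, hy⟩, rfl⟩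
        exact ⟨hx, y, hy, rfl⟩
    · rw [← Set.ncard_image_of_injective _ H.injective_subtype]
      congr 1
      ext x
      simp [and_comm]

theorem ncard_diff_zero (H : Submodule F V) :
    (((H : Set V) \ {0}).ncard : ℤ) = (Nat.card F : ℤ) ^ finrank F H - 1 := by
  have : Finite V := Module.finite_of_finite F
  have h := Set.ncard_sdiff_singleton_add_one (s := (H : Set V)) H.zero_mem (Set.toFinite _)
  have h' : (H : Set V).ncard = Nat.card F ^ finrank F H := Module.natCard_eq_pow_finrank (K := F)
  rw [h'] at h
  rw [← Nat.cast_pow, ← h]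
  push_cast
  ring

/-- The number of holes of a partial spread in a subspace. -/
theorem ncard_holes (C : Finset (Submodule F V)) (hC : ∀ U ∈ C, ∀ W ∈ C, U ≠ W → U ⊓ W = ⊥)
    (H : Submodule F V) :
    ((({x : V | x ≠ 0 ∧ ∀ U ∈ C, x ∉ U} ∩ H).ncard : ℕ) : ℤ) =
      (Nat.card F : ℤ) ^ finrank F H - 1 -
        ∑ U ∈ C, ((Nat.card F : ℤ) ^ finrank F ↥(U ⊓ H) - 1) := by
  classical
  have : Finite V := Module.finite_of_finite F
  let A : Submodule F V → Finset V := fun U => (Set.toFinite (((U ⊓ H : Submodule F V) : Set V) \ {0})).toFinset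
  have hA : ∀ U, ((A U).card : ℤ) = (Nat.card F : ℤ) ^ finrank F ↥(U ⊓ H) - 1 := fun U => by
    rw [← ncard_diff_zero, Set.ncard_eq_toFinset_card _ (Set.toFinite _)]
  have hdisj : (C : Set (Submodule F V)).PairwiseDisjoint A := by
    intro U hU W hW hne
    refine Finset.disjoint_left.mpr fun x hx hx' => ?_
    simp only [A, Set.Finite.mem_toFinset] at hx hx'
    have : x ∈ U ⊓ W := ⟨hx.1.1, hx'.1.1⟩
    rw [hC U hU W hW hne] at this
    exact hx.2 this
  have hunion : (H : Set V) \ {0} =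
      ({x : V | x ≠ 0 ∧ ∀ U ∈ C, x ∉ U} ∩ H) ∪ (C.biUnion A : Finset V) := by
    ext x
    simp only [A, Set.mem_sdiff, SetLike.mem_coe, Set.mem_singleton_iff, Set.mem_union,
      Set.mem_inter_iff, Set.mem_ofPred_eq, Finset.mem_biUnion,
      Set.Finite.mem_toFinset, Submodule.mem_inf]
    by_cases h : ∃ U ∈ C, x ∈ U
    · obtain ⟨U, hU, hx⟩ := h
      exact ⟨fun h => Or.inr ⟨U, hU, ⟨hx, h.1⟩, h.2⟩,
        fun h => h.elim (fun h => absurd hx (h.1.2 U hU)) fun ⟨_, _, h⟩ => ⟨h.1.2, h.2⟩⟩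
    · push Not at h
      exact ⟨fun hx => Or.inl ⟨⟨hx.2, h⟩, hx.1⟩,
        fun hx => hx.elim (fun hx => ⟨hx.2, hx.1.1⟩) fun ⟨U, hU, hx⟩ => absurd hx.1.1 (h U hU)⟩
  have hdisj' : Disjoint ({x : V | x ≠ 0 ∧ ∀ U ∈ C, x ∉ U} ∩ H) ((C.biUnion A : Finset V) : Set V) := by
    refine Set.disjoint_left.mpr fun x hx hx' => ?_
    simp only [A, Finset.mem_coe, Finset.mem_biUnion, Set.Finite.mem_toFinset] at hx'
    obtain ⟨U, hU, hx'⟩ := hx'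
    exact hx.1.2 U hU hx'.1.1
  rw [← ncard_diff_zero, hunion, Set.ncard_union_eq hdisj' (Set.toFinite _) (Set.toFinite _),
    Set.ncard_coe_finset, Finset.card_biUnion hdisj]
  push_cast
  rw [Finset.sum_congr rfl fun U _ => hA U]
  ring

theorem exists_pow_eq (x : ℤ) (n : ℕ) : ∃ y, x ^ n = 1 + (x - 1) * y := by
  obtain ⟨y, hy⟩ := sub_one_dvd_pow_sub_one x n
  exact ⟨y, by linarith⟩

/-- Each codeword meets `H` in dimension at least `k - j`, so every power of `q` in the hole count
is `q ^ (k - j)` times a number congruent to `1` modulo `q - 1`. With `X + 2` codewords and `q ^ k ∣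
X`, the residues left over are exactly the `-1` and `+1`. -/
theorem exists_ncard_holes_eq {k j X : ℕ} (C : Finset (Submodule F V))
    (hC : ∀ U ∈ C, ∀ W ∈ C, U ≠ W → U ⊓ W = ⊥) (hk : ∀ U ∈ C, finrank F U = k)
    (hX : C.card = X + 2) (hqX : Nat.card F ^ k ∣ X) (H : Submodule F V)
    (hH : finrank F H + j = finrank F V) (hjk : j ≤ k) (hkV : k ≤ finrank F V) :
    ∃ c : ℤ, (({x : V | x ≠ 0 ∧ ∀ U ∈ C, x ∉ U} ∩ H).ncard : ℤ) =
      (Nat.card F : ℤ) ^ (k - j) * (((Nat.card F : ℤ) - 1) * c - 1) + 1 := by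
  rw [ncard_holes C hC H]
  set q : ℤ := (Nat.card F : ℤ) with hq
  have h1 : ∀ U ∈ C, k - j ≤ finrank F ↥(U ⊓ H) := fun U hU => by
    have h2 := Submodule.finrank_sup_add_finrank_inf_eq U H
    have h3 := Submodule.finrank_le (U ⊔ H)
    rw [hk U hU] at h2
    omega
  have h2 : ∀ n, k - j ≤ n → ∃ y, q ^ n = q ^ (k - j) * (1 + (q - 1) * y) := fun n hn => by
    obtain ⟨y, hy⟩ := exists_pow_eq q (n - (k - j))
    exact ⟨y, by rw [← hy, ← pow_add, Nat.add_sub_cancel' hn]⟩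
  obtain ⟨y₀, hy₀⟩ := h2 (finrank F H) (by omega)
  have h3 : ∀ U, ∃ y, U ∈ C → q ^ finrank F ↥(U ⊓ H) = q ^ (k - j) * (1 + (q - 1) * y) := fun U => by
    by_cases hU : U ∈ C
    · obtain ⟨y, hy⟩ := h2 _ (h1 U hU)
      exact ⟨y, fun _ => hy⟩
    · exact ⟨0, fun h => absurd h hU⟩
  choose y hy using h3
  obtain ⟨w, hw⟩ := hqX
  obtain ⟨z, hz⟩ := exists_pow_eq q (k - j)
  have hw' : (X : ℤ) = q ^ (k - j) * (q ^ j * w) := by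
    rw [← mul_assoc, ← pow_add, Nat.sub_add_cancel hjk, hw]
    push_cast
    rfl
  refine ⟨y₀ - ∑ U ∈ C, y U - q ^ j * w * z, ?_⟩
  rw [Finset.sum_sub_distrib, Finset.sum_congr rfl (hy · ·), ← Finset.mul_sum,
    Finset.sum_add_distrib, ← Finset.mul_sum, hy₀]
  simp only [Finset.sum_const, hX, nsmul_eq_mul, mul_one]
  push_cast
  linear_combination (1 - q ^ (k - j)) * hw' - q ^ (k - j) * (q ^ j * w) * hz

/-- The bound of Năstase and Sissokho on partial spreads. -/
theorem card_partialSpread_le {k r R X : ℕ} (hkV : k ≤ finrank F V)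
    (hX : (X : ℤ) * ((Nat.card F : ℤ) ^ k - 1) + (Nat.card F : ℤ) ^ (k + r) =
      (Nat.card F : ℤ) ^ finrank F V)
    (hR : ((Nat.card F : ℤ) - 1) * R + 1 = (Nat.card F : ℤ) ^ r) (hRk : R < k)
    (C : Finset (Submodule F V)) (hC : ∀ U ∈ C, ∀ W ∈ C, U ≠ W → U ⊓ W = ⊥)
    (hk : ∀ U ∈ C, finrank F U = k) : C.card ≤ X + 1 := by
  by_contra! hlt
  obtain ⟨D, hDC, hD⟩ := Finset.exists_subset_card_eq (show X + 2 ≤ C.card by omega)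
  have hC' : ∀ U ∈ D, ∀ W ∈ D, U ≠ W → U ⊓ W = ⊥ := fun U hU W hW => hC U (hDC hU) W (hDC hW)
  have hk' : ∀ U ∈ D, finrank F U = k := fun U hU => hk U (hDC hU)
  have hq1 : 1 < Nat.card F := Finite.one_lt_card
  have hqX : Nat.card F ^ k ∣ X := by
    zify
    have h : (X : ℤ) = (Nat.card F : ℤ) ^ k * X + (Nat.card F : ℤ) ^ (k + r) -
        (Nat.card F : ℤ) ^ finrank F V := by linear_combination -hX
    rw [h]
    exact dvd_sub (dvd_add (dvd_mul_right _ _) (pow_dvd_pow _ (Nat.le_add_right k r)))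
      (pow_dvd_pow _ hkV)
  set T := {x : V | x ≠ 0 ∧ ∀ U ∈ D, x ∉ U} with hT
  -- Averaging gives successive hyperplanes with few holes, and the congruence on hole counts makes
  -- the integer coefficient drop by at least one each time.
  have key : ∀ j ≤ R, ∃ H : Submodule F V, finrank F H + j = finrank F V ∧
      ((T ∩ H).ncard : ℤ) ≤
        (Nat.card F : ℤ) ^ (k - j) * (((Nat.card F : ℤ) - 1) * (R - j) - 1) + 1 := by
    intro j
    induction j with
    | zero =>
      intro _
      refine ⟨⊤, by simp, le_of_eq ?_⟩
      rw [hT, ncard_holes D hC', Finset.sum_congr rfl fun U hU => by rw [inf_top_eq, hk' U hU]]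
      simp only [finrank_top, Finset.sum_const, hD, nsmul_eq_mul, Nat.cast_add, Nat.cast_ofNat,
        Nat.sub_zero, Nat.cast_zero, sub_zero]
      rw [pow_add] at hX
      linear_combination -hX - (Nat.card F : ℤ) ^ k * hR
    | succ j ih =>
      intro hj
      obtain ⟨H, hH, hle⟩ := ih (by omega)
      obtain ⟨H', -, hH', hle'⟩ := exists_hyperplane_card_le H (by omega) T (by simp [hT])
      obtain ⟨c, hc⟩ := exists_ncard_holes_eq (j := j + 1) D hC' hk' hD hqX H' (by omega)
        (by omega) hkV
      rw [← hT] at hc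
      refine ⟨H', by omega, ?_⟩
      have hle'' : (Nat.card F : ℤ) * (T ∩ H').ncard ≤ (T ∩ H).ncard := by exact_mod_cast hle'
      have hpow : (Nat.card F : ℤ) ^ (k - j) = Nat.card F * (Nat.card F : ℤ) ^ (k - (j + 1)) := by
        rw [← pow_succ']
        congr 1
        omega
      rw [hc] at hle'' ⊢
      have hq2 : (1 : ℤ) < Nat.card F := by exact_mod_cast hq1
      rw [hpow] at hle
      have hpos : 0 < (Nat.card F : ℤ) * (Nat.card F : ℤ) ^ (k - (j + 1)) := by positivity
      have hlt : ((Nat.card F : ℤ) - 1) * c < ((Nat.card F : ℤ) - 1) * (R - j) := by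
        refine lt_of_mul_lt_mul_left ?_ hpos.le
        linarith
      have hlt' : c < R - j := lt_of_mul_lt_mul_left hlt (by linarith)
      have hc' : c ≤ R - ((j + 1 : ℕ) : ℤ) := by
        push_cast
        linarith
      gcongr
  -- At `j = R` the bound is `1 - q ^ (k - R)`, negative because `R < k`.
  obtain ⟨H, -, hH⟩ := key R le_rfl
  have h1 : (1 : ℤ) < (Nat.card F : ℤ) ^ (k - R) :=
    one_lt_pow₀ (by exact_mod_cast hq1) (by omega)
  rw [sub_self, mul_zero] at hH
  have h2 : (0 : ℤ) ≤ ((T ∩ H).ncard : ℤ) := by positivity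
  linarith

/-- The trivial counting bound for partial spreads. -/
theorem card_mul_le_of_disjoint {a : ℕ} (C : Finset (Submodule F V))
    (hC : ∀ U ∈ C, ∀ W ∈ C, U ≠ W → U ⊓ W = ⊥) (ha : ∀ U ∈ C, finrank F U = a) :
    (C.card : ℤ) * ((Nat.card F : ℤ) ^ a - 1) ≤ (Nat.card F : ℤ) ^ finrank F V - 1 := by
  have h := ncard_holes C hC ⊤
  rw [Finset.sum_congr rfl fun U hU => by rw [inf_top_eq, ha U hU], Finset.sum_const, finrank_top,
    nsmul_eq_mul] at h
  have : (0 : ℤ) ≤ (({x : V | x ≠ 0 ∧ ∀ U ∈ C, x ∉ U} ∩ (⊤ : Submodule F V)).ncard : ℤ) := by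
    positivity
  linarith

/-- The counting bound for a code whose codewords pairwise span the whole space. -/
theorem card_mul_le_of_codisjoint {a : ℕ} (C : Finset (Submodule F V))
    (hC : ∀ U ∈ C, ∀ W ∈ C, U ≠ W → U ⊔ W = ⊤) (ha : ∀ U ∈ C, finrank F U + a = finrank F V) :
    (C.card : ℤ) * ((Nat.card F : ℤ) ^ a - 1) ≤ (Nat.card F : ℤ) ^ finrank F V - 1 := by
  classical
  have hinj : Function.Injective (Submodule.dualAnnihilator : Submodule F V → _) :=
    fun _ _ h => Subspace.dualAnnihilator_inj.mp h
  -- Annihilators turn subspaces that pairwise span `V` into pairwise disjoint `a`-spaces of the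
  -- dual.
  have h := card_mul_le_of_disjoint (a := a) (C.image Submodule.dualAnnihilator) (by
    simp only [Finset.forall_mem_image]
    intro U hU W hW hne
    rw [← Submodule.dualAnnihilator_sup_eq, hC U hU W hW fun h => hne (h ▸ rfl),
      Submodule.dualAnnihilator_top]) (by
    simp only [Finset.forall_mem_image]
    intro U hU
    have := Subspace.finrank_add_finrank_dualAnnihilator_eq U
    have := ha U hU
    omega)
  rwa [Finset.card_image_of_injective _ hinj, Subspace.dual_finrank_eq] at h

end Holes

/-! ### Partial spreads and codes attaining the bounds. -/

section PartialSpreads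
variable {F : Type*} [Field F]

theorem IsCDC.inf_eq_bot {v k : ℕ} {C : Finset (Submodule F (Fin v → F))}
    (hC : IsCDC F v (2 * k) k C) : ∀ U ∈ C, ∀ W ∈ C, U ≠ W → U ⊓ W = ⊥ := fun U hU W hW hne => by
  have := ((isCDC_iff C).mp hC).2 U hU W hW hne
  exact Submodule.finrank_eq_zero.mp (by omega)

variable [Finite F]

theorem exists_isCDC_card_eq_maxCDC (F : Type*) [Field F] [Finite F] (v d k : ℕ) :
    ∃ C : Finset (Submodule F (Fin v → F)), IsCDC F v d k C ∧ C.card = maxCDC F v d k :=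
  (isGreatest_maxCDC F v d k).1

/-- A partial spread of the special subspace extends a lifted MRD code. -/
theorem exists_partialSpread_with_LMRD {v k : ℕ} (hk : 1 ≤ k) (hkv : 2 * k ≤ v) :
    ∃ C : Finset (Submodule F (Fin v → F)), IsCDCWithLMRD F v (2 * k) k C ∧
      C.card = Nat.card F ^ (v - k) + maxCDC F (v - k) (2 * k) k := by
  obtain ⟨D, hD, hDc⟩ := exists_isCDC_card_eq_maxCDC F (v - k) (2 * k) k
  -- For `δ = k` the head factors have dimension zero, so `⊥` may be used for every index.
  obtain ⟨C, hC, hCc⟩ := exists_isCDCWithLMRD hkv hk le_rfl D (fun _ => ⊥) id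
    (by simp) hD.1 (by simp) (fun U hU W hW hne => by simp [hD.inf_eq_bot U hU W hW hne])
  refine ⟨C, hC, ?_⟩
  rw [hCc, hDc, Nat.sub_self, zero_add, mul_one]

/-- The size `∑_{i = 1}^m q ^ (i k + r)`, one less than that of the standard partial spread in
dimension `(m + 1) k + r`. -/
def spreadSize (q k r m : ℕ) : ℕ := ∑ i ∈ Finset.range m, q ^ ((i + 1) * k + r)

theorem spreadSize_mul (q k r m : ℕ) :
    (spreadSize q k r m : ℤ) * ((q : ℤ) ^ k - 1) + (q : ℤ) ^ (k + r) =
      (q : ℤ) ^ ((m + 1) * k + r) := by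
  induction m with
  | zero => simp [spreadSize]
  | succ m ih =>
    have h : spreadSize q k r (m + 1) = spreadSize q k r m + q ^ ((m + 1) * k + r) :=
      Finset.sum_range_succ _ _
    rw [h, show (m + 1 + 1) * k + r = ((m + 1) * k + r) + k by ring, pow_add _ ((m + 1) * k + r)]
    push_cast
    linear_combination ih

/-- Recursive construction: a lifted MRD code together with a partial spread of its special
subspace, starting from a single `k`-space. -/
theorem spreadSize_lt_maxCDC (F : Type*) [Field F] [Finite F] {k : ℕ} (hk : 1 ≤ k) (r m : ℕ) :
    spreadSize (Nat.card F) k r m + 1 ≤ maxCDC F ((m + 1) * k + r) (2 * k) k := by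
  induction m with
  | zero =>
    obtain ⟨K, -, hK⟩ := exists_le_finrank_eq (⊤ : Submodule F (Fin ((0 + 1) * k + r) → F))
      (t := k) (by simp)
    refine (isGreatest_maxCDC F _ _ _).2 ⟨{K}, ?_, by simp [spreadSize]⟩
    simp [isCDC_iff, hK]
  | succ m ih =>
    obtain ⟨C, hC, hCc⟩ := exists_partialSpread_with_LMRD (F := F) (v := (m + 1 + 1) * k + r) hk
      (by nlinarith)
    have h : spreadSize (Nat.card F) k r (m + 1) =
      spreadSize (Nat.card F) k r m + Nat.card F ^ ((m + 1) * k + r) := Finset.sum_range_succ _ _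
    rw [show (m + 1 + 1) * k + r - k = (m + 1) * k + r by
      rw [add_mul (m + 1), one_mul]; omega] at hCc
    have := (isGreatest_maxCDC F _ _ _).2 ⟨C, hC.1, rfl⟩
    omega

theorem maxCDC_eq_spreadSize (F : Type*) [Field F] [Finite F] {k r R : ℕ} (m : ℕ) (hk : 1 ≤ k)
    (hR : ((Nat.card F : ℤ) - 1) * R + 1 = (Nat.card F : ℤ) ^ r) (hRk : R < k) :
    maxCDC F ((m + 1) * k + r) (2 * k) k = spreadSize (Nat.card F) k r m + 1 := by
  refine le_antisymm ?_ (spreadSize_lt_maxCDC F hk r m)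
  obtain ⟨D, hD, hDc⟩ := exists_isCDC_card_eq_maxCDC F ((m + 1) * k + r) (2 * k) k
  rw [← hDc]
  refine card_partialSpread_le (k := k) (r := r) (R := R) ?_ ?_ hR hRk D hD.inf_eq_bot hD.1
  · rw [finrank_fin_fun]
    nlinarith
  · rw [finrank_fin_fun]
    exact spreadSize_mul _ _ _ _

/-- The hyperplane descent takes `[r]_q` steps, so the rational `[r]_q` is needed as the natural
number `1 + q + ⋯ + q ^ (r - 1)`. -/
theorem exists_nat_eq_gaussBinom_one {q : ℕ} (hq : 1 < q) (r : ℕ) :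
    ∃ R : ℕ, ((q : ℤ) - 1) * R + 1 = (q : ℤ) ^ r ∧ gaussBinom q r 1 = R := by
  have hq' : (q : ℚ) - 1 ≠ 0 := by
    have : (1 : ℚ) < q := by exact_mod_cast hq
    linarith
  refine ⟨∑ i ∈ Finset.range r, q ^ i, ?_, ?_⟩
  · push_cast
    rw [mul_geom_sum]
    ring
  · unfold gaussBinom
    split_ifs with h
    · push_cast
      rw [Finset.prod_range_one, pow_zero, pow_one, geom_sum_eq (sub_ne_zero.mp hq')]
    · obtain rfl : r = 0 := by omega
      simp

/-- A partial spread with enough elements in the quotient by the special subspace makes the first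
bound attained. -/
theorem exists_code_of_maxCDC_le {v k δ : ℕ} (hkv : 2 * k ≤ v) (hδ : 1 ≤ δ) (hδk : δ ≤ k)
    (hk : k < 2 * δ)
    (h : maxCDC F (v - k) (2 * (2 * δ - k)) δ ≤ maxCDC F k (2 * (k - δ)) (k - δ)) :
    ∃ C : Finset (Submodule F (Fin v → F)), IsCDCWithLMRD F v (2 * δ) k C ∧
      C.card = Nat.card F ^ ((v - k) * (k - δ + 1)) + maxCDC F (v - k) (2 * (2 * δ - k)) δ := by
  obtain ⟨D, hD, hDc⟩ := exists_isCDC_card_eq_maxCDC F (v - k) (2 * (2 * δ - k)) δ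
  obtain ⟨Q, hQ, hQc⟩ := exists_isCDC_card_eq_maxCDC F k (2 * (k - δ)) (k - δ)
  -- Hypothesis `h` leaves enough elements of `Q` to give each element of `D` its own disjoint head
  -- factor.
  let K : Fin (D.card) → Submodule F (Fin (v - k) → F) := fun i => (D.equivFin.symm i).1
  let P : Fin (D.card) → Submodule F (Fin k → F) := fun i =>
    (Q.equivFin.symm (Fin.castLE (by omega) i)).1
  have hK : ∀ i, K i ∈ D := fun i => (D.equivFin.symm i).2
  have hP : ∀ i, P i ∈ Q := fun i => (Q.equivFin.symm _).2
  have hKinj : Function.Injective K := Subtype.val_injective.comp D.equivFin.symm.injective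
  have hPinj : Function.Injective P := Subtype.val_injective.comp
    (Q.equivFin.symm.injective.comp (Fin.castLE_injective _))
  obtain ⟨C, hC, hCc⟩ := exists_isCDCWithLMRD hkv hδ hδk Finset.univ P K
    (fun i _ => hQ.1 _ (hP i)) (fun i _ => hD.1 _ (hK i))
    (fun i _ j _ hij => hQ.inf_eq_bot _ (hP i) _ (hP j) (hPinj.ne hij))
    (fun i _ j _ hij => by
      have := ((isCDC_iff D).mp hD).2 _ (hK i) _ (hK j) (hKinj.ne hij)
      omega)
  exact ⟨C, hC, by rw [hCc, Finset.card_univ, Fintype.card_fin, hDc]⟩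

/-- Counting bound for `δ`-spaces in `F ^ n` that pairwise meet in dimension at most
`2 δ - n`. -/
theorem maxCDC_mul_le {n δ : ℕ} (hδ : δ ≤ n) :
    (maxCDC F n (2 * (n - δ)) δ : ℤ) * ((Nat.card F : ℤ) ^ (n - δ) - 1) ≤
      (Nat.card F : ℤ) ^ n - 1 := by
  obtain ⟨D, hD, hDc⟩ := exists_isCDC_card_eq_maxCDC F n (2 * (n - δ)) δ
  have hD' := (isCDC_iff D).mp hD
  have h := card_mul_le_of_codisjoint (a := n - δ) D (fun U hU W hW hne => by
    have h1 := hD'.2 U hU W hW hne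
    have h2 := Submodule.finrank_sup_add_finrank_inf_eq U W
    have h3 := Submodule.finrank_le (U ⊔ W)
    rw [hD.1 U hU, hD.1 W hW] at h2
    rw [finrank_fin_fun] at h3
    exact Submodule.eq_top_of_finrank_eq (by rw [finrank_fin_fun]; omega)) (fun U hU => by
    rw [hD.1 U hU, finrank_fin_fun]
    omega)
  rwa [finrank_fin_fun, hDc] at h

/-- A number is at most the size of a spread if it passes the counting bound. -/
theorem le_maxCDC_of_mul_le {a m N : ℕ} (ha : 1 ≤ a)
    (h : (N : ℤ) * ((Nat.card F : ℤ) ^ a - 1) ≤ (Nat.card F : ℤ) ^ ((m + 1) * a) - 1) :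
    N ≤ maxCDC F ((m + 1) * a) (2 * a) a := by
  refine le_trans ?_ (spreadSize_lt_maxCDC F ha 0 m)
  have h1 := spreadSize_mul (Nat.card F) a 0 m
  have hq : (1 : ℤ) < (Nat.card F : ℤ) ^ a :=
    one_lt_pow₀ (by exact_mod_cast Finite.one_lt_card) (by omega)
  rw [add_zero, add_zero] at h1
  zify
  refine le_of_mul_le_mul_right ?_ (show 0 < (Nat.card F : ℤ) ^ a - 1 by linarith)
  linarith

/-- Dual counting bounds the left side by `(q ^ (3 + 2 * l) - 1) / (q ^ (1 + l) - 1)`, which is at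
most the number of points of `F ^ (3 + l)`. -/
theorem maxCDC_le_first_family (F : Type*) [Field F] [Finite F] {l : ℕ} (hl : 1 ≤ l) :
    maxCDC F (3 + 2 * l) (2 * (1 + l)) (2 + l) ≤ maxCDC F (3 + l) (2 * 1) 1 := by
  have h := maxCDC_mul_le (F := F) (n := 3 + 2 * l) (δ := 2 + l) (by omega)
  rw [show 3 + 2 * l - (2 + l) = 1 + l by omega] at h
  have h2 := le_maxCDC_of_mul_le (F := F) (a := 1) (m := 2 + l)
    (N := maxCDC F (3 + 2 * l) (2 * (1 + l)) (2 + l)) le_rfl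
  rw [show (2 + l + 1) * 1 = 3 + l by ring] at h2
  refine h2 ?_
  generalize maxCDC F (3 + 2 * l) (2 * (1 + l)) (2 + l) = N at h
  have hq : (2 : ℤ) ≤ Nat.card F := by exact_mod_cast Finite.one_lt_card
  generalize (Nat.card F : ℤ) = q at h hq
  obtain ⟨s, rfl⟩ := Nat.exists_eq_add_of_le hl
  have e1 : q ^ (3 + 2 * (1 + s)) = q ^ 5 * (q ^ s * q ^ s) := by ring
  have e2 : q ^ (1 + (1 + s)) = q ^ 2 * q ^ s := by ring
  have e3 : q ^ (3 + (1 + s)) = q ^ 4 * q ^ s := by ring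
  rw [e1, e2] at h
  rw [e3, pow_one]
  have hA : 1 ≤ q ^ s := one_le_pow₀ (by linarith)
  generalize q ^ s = A at h hA
  have hp : 0 < q ^ 2 * A - 1 := by nlinarith
  -- With `A = q ^ (l - 1)`, this is the comparison of the two fractions after cross-multiplying and
  -- cancelling.
  have hkey : q ^ 4 * A + q ^ 2 * A ≤ q ^ 5 * (A * A) + q := by
    have : q ^ 5 * A ≤ q ^ 5 * (A * A) := by
      gcongr
      nlinarith
    have h5 : q ^ 4 * A + q ^ 2 * A ≤ q ^ 5 * A := by
      rw [← add_mul]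
      gcongr
      nlinarith [pow_pos (show 0 < q by linarith) 4, pow_pos (show 0 < q by linarith) 2,
        mul_le_mul_of_nonneg_right hq (pow_pos (show 0 < q by linarith) 4).le]
    linarith
  refine le_of_mul_le_mul_right ?_ hp
  nlinarith [mul_le_mul_of_nonneg_right h (show 0 ≤ q - 1 by linarith)]

/-- The dual counting bound is exactly the size of a spread of `l`-spaces in `F ^ (3 * l)`. -/
theorem maxCDC_le_second_family (F : Type*) [Field F] [Finite F] {l : ℕ} (hl : 1 ≤ l) :
    maxCDC F (3 * l) (2 * l) (2 * l) ≤ maxCDC F (3 * l) (2 * l) l := by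
  have h := maxCDC_mul_le (F := F) (n := 3 * l) (δ := 2 * l) (by omega)
  rw [show 3 * l - 2 * l = l by omega] at h
  exact le_maxCDC_of_mul_le (F := F) (a := l) (m := 2) hl h

/-- A lifted MRD code can be extended by one codeword. -/
theorem exists_code_add_one {v k δ : ℕ} (hkv : 2 * k ≤ v) (hδ : 1 ≤ δ) (hδk : δ ≤ k) :
    ∃ C : Finset (Submodule F (Fin v → F)), IsCDCWithLMRD F v (2 * δ) k C ∧
      C.card = Nat.card F ^ ((v - k) * (k - δ + 1)) + 1 := by
  obtain ⟨P, -, hP⟩ := exists_le_finrank_eq (⊤ : Submodule F (Fin k → F)) (t := k - δ) (by simp)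
  obtain ⟨K, -, hK⟩ := exists_le_finrank_eq (⊤ : Submodule F (Fin (v - k) → F)) (t := δ)
    (by rw [finrank_top, finrank_fin_fun]; omega)
  obtain ⟨C, hC, hCc⟩ := exists_isCDCWithLMRD hkv hδ hδk (Finset.univ : Finset Unit)
    (fun _ => P) (fun _ => K) (fun _ _ => hP) (fun _ _ => hK) (by simp) (by simp)
  exact ⟨C, hC, by simpa using hCc⟩

theorem card_le_of_lt {v k δ : ℕ} (hkv : 2 * k ≤ v) (hδk : δ ≤ k) (hk : k < 2 * δ)
    {C : Finset (Submodule F (Fin v → F))} (hC : IsCDCWithLMRD F v (2 * δ) k C) :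
    C.card ≤ Nat.card F ^ ((v - k) * (k - δ + 1)) + maxCDC F (v - k) (2 * (2 * δ - k)) δ := by
  obtain ⟨D, hDC, hD, hc⟩ := hC.exists_extra hkv hδk
  rw [hc, show 2 * δ - k = δ + δ - k by omega]
  gcongr
  exact card_le_maxCDC_of_le_finrank_inf (by omega) (by omega) hC.1 hDC hD

theorem card_le_of_le {v k δ : ℕ} (hkv : 2 * k ≤ v) (hδ : 2 ≤ δ) (hδk : 2 * δ ≤ k)
    (hk : k < 3 * δ) {C : Finset (Submodule F (Fin v → F))} (hC : IsCDCWithLMRD F v (2 * δ) k C) :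
    (C.card : ℚ) ≤ (Nat.card F : ℚ) ^ ((v - k) * (k - δ + 1))
      + (maxCDC F (v - k) (3 * (2 * δ) - 2 * k) (2 * δ) : ℚ)
      + gaussBinom (Nat.card F) (v - k) δ * gaussBinom (Nat.card F) k (2 * δ - 1)
        * (Nat.card F : ℚ) ^ ((k - 2 * δ + 1) * (v - k - δ))
        / gaussBinom (Nat.card F) (k - δ) (δ - 1) := by
  classical
  obtain ⟨D, hDC, hD, hc⟩ := hC.exists_extra hkv (by omega)
  have hkv' : k ≤ v := by omega
  -- The extra codewords are split by whether they meet the special subspace in dimension at least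
  -- `2 * δ`; the two classes give the last two summands.
  rw [hc, ← Finset.card_filter_add_card_filter_not
    (s := D) fun U => 2 * δ ≤ finrank F ↥(U ⊓ LinearMap.ker (headMap F hkv'))]
  push_cast
  rw [add_assoc]
  refine add_le_add le_rfl (add_le_add ?_ ?_)
  · rw [show 3 * (2 * δ) - 2 * k = 2 * (2 * δ + δ - k) by omega]
    exact_mod_cast card_le_maxCDC_of_le_finrank_inf hkv' (by omega) hC.1
      ((Finset.filter_subset _ _).trans hDC) fun U hU => (Finset.mem_filter.mp hU).2
  · exact card_le_of_finrank_inf_lt hkv hδ hδk hC.1 ((Finset.filter_subset _ _).trans hDC)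
      (fun U hU => hD U (Finset.mem_filter.mp hU).1)
      fun U hU => not_le.mp (Finset.mem_filter.mp hU).2

/-- Both maxima are explicit geometric sums, and passing from `v - k` to `v` adds the single term `q
^ (v - k)`. -/
theorem maxCDC_partialSpread_eq {v k r : ℕ} (hk : 1 ≤ k) (hkv : 2 * k ≤ v)
    (hr : r ≡ v [MOD k]) (hrk : r < k) (hgr : gaussBinom (Nat.card F) r 1 < (k : ℚ)) :
    Nat.card F ^ (v - k) + maxCDC F (v - k) (2 * k) k = maxCDC F v (2 * k) k := by
  obtain ⟨R, hR, hgR⟩ := exists_nat_eq_gaussBinom_one (q := Nat.card F) Finite.one_lt_card r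
  have hRk : R < k := by
    rw [hgR] at hgr
    exact_mod_cast hgr
  have hv : k * (v / k) + r = v := by
    rw [← Nat.mod_eq_of_lt hrk, hr]
    exact Nat.div_add_mod v k
  obtain ⟨m, hm⟩ : ∃ m, v / k = m + 2 :=
    ⟨v / k - 2, by have := (Nat.le_div_iff_mul_le (by omega)).mpr hkv; omega⟩
  rw [hm] at hv
  have hv1 : v = (m + 1 + 1) * k + r := by rw [← hv]; ring
  have hv2 : v - k = (m + 1) * k + r := by
    rw [hv1, add_mul (m + 1), one_mul]
    omega
  have h1 := maxCDC_eq_spreadSize F (m + 1) hk hR hRk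
  have h2 := maxCDC_eq_spreadSize F m hk hR hRk
  have h : spreadSize (Nat.card F) k r (m + 1) =
      spreadSize (Nat.card F) k r m + Nat.card F ^ ((m + 1) * k + r) := Finset.sum_range_succ _ _
  rw [hv2, hv1, h1, h2, h]
  ring

end PartialSpreads

end LMRDBound

theorem mainTheorem1 (F : Type*) [Field F] [Finite F] (q : ℕ) (hq : Nat.card F = q)
    (v d k : ℕ) (hd : Even d) (h2 : 2 ≤ d / 2) (hdk : d / 2 ≤ k) (hkv : 2 * k ≤ v) :
    -- the range `k < d ≤ 2 v / 3`
    (k < d → 3 * d ≤ 2 * v →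
      (∀ C : Finset (Submodule F (Fin v → F)), LMRDBound.IsCDCWithLMRD F v d k C →
        C.card ≤ q ^ ((v - k) * (k - d / 2 + 1))
          + LMRDBound.maxCDC F (v - k) (2 * (d - k)) (d / 2)) ∧
      (∀ r : ℕ, d = 2 * k → r ≡ v [MOD k] → r < k → LMRDBound.gaussBinom q r 1 < (k : ℚ) →
        q ^ ((v - k) * (k - d / 2 + 1)) + LMRDBound.maxCDC F (v - k) (2 * (d - k)) (d / 2)
            = LMRDBound.maxCDC F v d k ∧
        ∃ C : Finset (Submodule F (Fin v → F)), LMRDBound.IsCDCWithLMRD F v d k C ∧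
          C.card = q ^ ((v - k) * (k - d / 2 + 1))
            + LMRDBound.maxCDC F (v - k) (2 * (d - k)) (d / 2))) ∧
    -- the two families in which the first bound is attained
    ((∃ l : ℕ, 1 ≤ l ∧ ((v, d, k) = (6 + 3 * l, 4 + 2 * l, 3 + l) ∨
          (v, d, k) = (6 * l, 4 * l, 3 * l))) →
      k < d ∧ 3 * d ≤ 2 * v ∧
      ∃ C : Finset (Submodule F (Fin v → F)), LMRDBound.IsCDCWithLMRD F v d k C ∧
        C.card = q ^ ((v - k) * (k - d / 2 + 1))
          + LMRDBound.maxCDC F (v - k) (2 * (d - k)) (d / 2)) ∧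
    -- the range `k < d`, `v < 3 d / 2`
    (k < d → 2 * v < 3 * d →
      (∀ C : Finset (Submodule F (Fin v → F)), LMRDBound.IsCDCWithLMRD F v d k C →
        C.card ≤ q ^ ((v - k) * (k - d / 2 + 1)) + 1) ∧
      ∃ C : Finset (Submodule F (Fin v → F)), LMRDBound.IsCDCWithLMRD F v d k C ∧
        C.card = q ^ ((v - k) * (k - d / 2 + 1)) + 1) ∧
    -- the range `d ≤ k < 3 d / 2`
    (d ≤ k → 2 * k < 3 * d →
      ∀ C : Finset (Submodule F (Fin v → F)), LMRDBound.IsCDCWithLMRD F v d k C →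
        (C.card : ℚ) ≤ (q : ℚ) ^ ((v - k) * (k - d / 2 + 1))
          + (LMRDBound.maxCDC F (v - k) (3 * d - 2 * k) d : ℚ)
          + LMRDBound.gaussBinom q (v - k) (d / 2) * LMRDBound.gaussBinom q k (d - 1)
            * (q : ℚ) ^ ((k - d + 1) * (v - k - d / 2))
            / LMRDBound.gaussBinom q (k - d / 2) (d / 2 - 1)) := by
  subst hq
  obtain ⟨δ, rfl⟩ : ∃ δ, d = 2 * δ := ⟨d / 2, by have := Nat.div_mul_cancel hd.two_dvd; omega⟩
  rw [Nat.mul_div_cancel_left δ two_pos] at h2 hdk ⊢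
  refine ⟨fun h1 _ => ?_, ?_, fun h1 h3 => ⟨fun C hC => ?_, ?_⟩, fun h1 h3 C hC => ?_⟩
  · refine ⟨fun C hC => LMRDBound.card_le_of_lt hkv hdk h1 hC, fun r hr1 hr hrk hgr => ?_⟩
    obtain rfl : δ = k := by omega
    have e : 2 * δ - δ = δ := by omega
    rw [e, Nat.sub_self, zero_add, mul_one]
    exact ⟨LMRDBound.maxCDC_partialSpread_eq (by omega) hkv hr hrk hgr,
      LMRDBound.exists_partialSpread_with_LMRD (by omega) hkv⟩
  · rintro ⟨l, hl, hl' | hl'⟩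
    · simp only [Prod.mk.injEq] at hl'
      obtain ⟨rfl, hδ, rfl⟩ := hl'
      obtain rfl : δ = 2 + l := by omega
      refine ⟨by omega, by omega, LMRDBound.exists_code_of_maxCDC_le hkv (by omega) hdk
        (by omega) ?_⟩
      -- Here `k - δ = 1`, so the disjoint head factors are the points of `F ^ k`.
      have e1 : 6 + 3 * l - (3 + l) = 3 + 2 * l := by omega
      have e2 : 2 * (2 + l) - (3 + l) = 1 + l := by omega
      have e3 : 3 + l - (2 + l) = 1 := by omega
      rw [e1, e2, e3]
      exact LMRDBound.maxCDC_le_first_family F hl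
    · simp only [Prod.mk.injEq] at hl'
      obtain ⟨rfl, hδ, rfl⟩ := hl'
      obtain rfl : δ = 2 * l := by omega
      refine ⟨by omega, by omega, LMRDBound.exists_code_of_maxCDC_le hkv (by omega) hdk
        (by omega) ?_⟩
      have e1 : 6 * l - 3 * l = 3 * l := by omega
      have e2 : 2 * (2 * l) - 3 * l = l := by omega
      have e3 : 3 * l - 2 * l = l := by omega
      rw [e1, e2, e3]
      exact LMRDBound.maxCDC_le_second_family F hl
  · obtain ⟨D, hDC, hD, hc⟩ := hC.exists_extra hkv hdk
    rw [hc]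
    gcongr
    exact LMRDBound.card_le_one_of_le_finrank_inf (by omega) (by omega) hC.1 hDC hD
  · exact LMRDBound.exists_code_add_one hkv (by omega) hdk
  · exact LMRDBound.card_le_of_le hkv h2 h1 (by omega) hC
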